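/- Let $\mathbb{F} \in \{\mathbb{R}, \mathbb{C}\}$. For $k \in \{1, 2, \ldots\}$ let $C(k;\mathbb{F})$ be the set of all $k \times k$ correlation matrices over $\mathbb{F}$, i.e. positive semidefinite matrices $\Sigma \in \mathbb{M}(k\times k;\mathbb{F})$ with $\Sigma_{ii} = 1$ for all $i$, and let $C_1(k;\mathbb{F})$ be the set of those of rank $1$. Let $\mathrm{acx}$ denote the absolute convex hull over $\mathbb{F}$ (the smallest convex and balanced superset), and let $K_G^{\mathbb{F}}$ be the Grothendieck constant, i.e. the smallest $K > 0$ such that for all $m, n$, all $(a_{ij}) \in \mathbb{M}(m\times n;\mathbb{F})$, every $\mathbb{F}$-Hilbert space $H$ and all unit vectors $u_1,\ldots,u_m,v_1,\ldots,v_n \in H$ $$\Big|\sum_{i=1}^m\sum_{j=1}^n a_{ij}\langle u_i, v_j\rangle_H\Big| \le K \sup\Big\{\Big|\sum_{i=1}^m\sum_{j=1}^n a_{ij}p_iq_j\Big| : p_i, q_j \in \mathbb{F},\ |p_i| = |q_j| = 1 \text{ for all } i,j\Big\}.$$ This smallest constant exists (and is finite). Moreover, there exists an absolute constant $K_*^{\mathbb{F}}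 > 1$ such that $$|\mathrm{tr}(B^*\Sigma)| \le K_*^{\mathbb{F}} \max_{\Theta \in C_1(k;\mathbb{F})} |\mathrm{tr}(B^*\Theta)|$$ for all $k \ge 1$, all $\Sigma \in C(k;\mathbb{F})$ and all $B \in \mathbb{M}(k\times k;\mathbb{F})$ (the maximum being attained), and the smallest constant $K_*^{\mathbb{F}}$ with this property exists, is greater than $1$, and satisfies $$C(k;\mathbb{F}) \subseteq K_*^{\mathbb{F}}\, \mathrm{acx}\big(C_1(k;\mathbb{F})\big) \quad \text{for all } k \ge 1,$$ as well as $K_*^{\mathbb{R}} \in \big[K_G^{\mathbb{R}}, \sinh(\tfrac{\pi}{2})\big]$ and $K_*^{\mathbb{C}} \in \big[K_G^{\mathbb{C}}, \tfrac{8}{\pi} - 1\big]$. -/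

import Mathlib

open scoped ComplexOrder Pointwise

universe u

noncomputable section

namespace Grothendieck

/-- `C(k; 𝕜)`: the `k × k` correlation matrices over `𝕜`, i.e. the positive semidefinite
matrices all of whose diagonal entries are `1`. -/
def correlationMatrices (𝕜 : Type) [RCLike 𝕜] (k : ℕ) : Set (Matrix (Fin k) (Fin k) 𝕜) :=
  {S | S.PosSemidef ∧ ∀ i, S i i = 1}

/-- `C₁(k; 𝕜)`: the `k × k` correlation matrices of rank one. -/
def rankOneCorrelationMatrices (𝕜 : Type) [RCLike 𝕜] (k : ℕ) :
    Set (Matrix (Fin k) (Fin k) 𝕜) :=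
  {T | T ∈ correlationMatrices 𝕜 k ∧ T.rank = 1}

/-- The set of values `|tr(B* Θ)|`, where `Θ` runs through `C₁(k; 𝕜)`. -/
def rankOneValues {𝕜 : Type} [RCLike 𝕜] {k : ℕ} (B : Matrix (Fin k) (Fin k) 𝕜) : Set ℝ :=
  {t | ∃ T ∈ rankOneCorrelationMatrices 𝕜 k, t = ‖(B.conjTranspose * T).trace‖}

/-- `K` is admissible in the correlation matrix inequality: for every `k ≥ 1` and every `k × k`
matrix `B`, the maximum `M` of `|tr(B* Θ)|` over `Θ ∈ C₁(k; 𝕜)` exists, and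
`|tr(B* Σ)| ≤ K M` for all `Σ ∈ C(k; 𝕜)`. -/
def IsCorrelationBound (𝕜 : Type) [RCLike 𝕜] (K : ℝ) : Prop :=
  ∀ k : ℕ, 1 ≤ k → ∀ B : Matrix (Fin k) (Fin k) 𝕜,
    ∃ M : ℝ, IsGreatest (rankOneValues B) M ∧
      ∀ S ∈ correlationMatrices 𝕜 k, ‖(B.conjTranspose * S).trace‖ ≤ K * M

/-- `K` is admissible in the Grothendieck inequality over `𝕜`. -/
def IsGrothendieckBound (𝕜 : Type) [RCLike 𝕜] (K : ℝ) : Prop :=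
  0 < K ∧
  ∀ (m n : ℕ) (a : Matrix (Fin m) (Fin n) 𝕜)
    (H : Type u) [NormedAddCommGroup H] [InnerProductSpace 𝕜 H] [CompleteSpace H]
    (x : Fin m → H) (y : Fin n → H), (∀ i, ‖x i‖ = 1) → (∀ j, ‖y j‖ = 1) →
    ‖∑ i, ∑ j, a i j * inner 𝕜 (x i) (y j)‖ ≤
      K * sSup {t : ℝ | ∃ (p : Fin m → 𝕜) (q : Fin n → 𝕜),
        (∀ i, ‖p i‖ = 1) ∧ (∀ j, ‖q j‖ = 1) ∧ t = ‖∑ i, ∑ j, a i j * p i * q j‖}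

/-- The Grothendieck constant `K_G` over `𝕜`: the smallest admissible constant. -/
def grothendieckConstant (𝕜 : Type) [RCLike 𝕜] : ℝ :=
  sInf {K : ℝ | IsGrothendieckBound.{u} 𝕜 K}

end Grothendieck

end

/-! Both fields reduce to two facts: some constant of the stated size is admissible for correlation
matrices, and `1` is not. The rest is soft (`constants_of_isCorrelationBound`). Admissible constants
form a closed set bounded below by 1, so a least one exists. Hahn–Banach turns the trace inequality
into the inclusion in the absolutely convex hull. The inequality for the Gram matrix of all the
vectors `x i`, `y j`, tested on a matrix with a single off-diagonal block, is Grothendieck's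
inequality with the same constant.

For the upper bounds let R be the closed convex hull of the rank-one correlation matrices
(`roundedMatrices`). Trace functionals on R are bounded by their maximum over rank one, and R is
stable under entrywise products, conjugation and averages of random unimodular vectors. Hence it
suffices to write a correlation matrix S as a real combination of elements of R and to add the
absolute values of the coefficients.

Real case: signs of Gaussians with covariance S show that A = (2/π) arcsin S lies in R. Expanding S
= sin(πA/2) in entrywise powers of A costs sinh(π/2).

Complex case: phases of complex Gaussians show that H = (π/4) S G(|S|²) lies in R, with G = ₂F₁(1/2,
1/2; 2; ·) and G(1) = 4/π. The key identity is G(x) - 1 = (x/8) G(x)³ exp(q(x)), where q has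
nonnegative coefficients. It gives S = (4/π) H - (4/π - 1) Q, where Q is the entrywise product of H,
H, the conjugate of H and E = exp(q(|S|²) - q(1)). The matrix E lies in R because exp(t(Re X - 1))
is an average of characters. The total cost is 8/π - 1. Nonnegativity of q compares the logarithmic
derivatives of G and of 8(G - 1)/x, by Kaluza's argument and a Riccati equation.

For strictness, explicit matrices of order 3 (real) and 4 (complex) beat every rank-one competitor.
-/

namespace Grothendieck

open Matrix

/-! ### Compact hulls and separation. -/

section ConvexHull

theorem sum_eq_sum_comp_embedding {ι κ F : Type*} [Fintype ι] [Fintype κ] [AddCommMonoid F]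
    (f : ι ↪ κ) (v : κ → F) (hv : ∀ j, j ∉ Set.range f → v j = 0) :
    ∑ j, v j = ∑ i, v (f i) := by
  rw [← Finset.sum_map Finset.univ f v]
  refine (Finset.sum_subset (Finset.subset_univ _) fun j _ hj => hv j ?_).symm
  simpa using hj

/-- In a finite-dimensional space the convex hull of a compact set is compact. -/
theorem isCompact_convexHull_of_finiteDimensional {E : Type*} [NormedAddCommGroup E]
    [NormedSpace ℝ E] [FiniteDimensional ℝ E] {s : Set E} (hs : IsCompact s) :
    IsCompact (convexHull ℝ s) := by
  classical
  rcases s.eq_empty_or_nonempty with rfl | ⟨x₀, hx₀⟩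
  · simp
  -- Carathéodory: `d` points suffice, so the hull is a continuous image of the simplex times `d`
  -- copies of `s`.
  set d := Module.finrank ℝ E + 1
  have hcpt : IsCompact ((stdSimplex ℝ (Fin d)) ×ˢ (Set.univ.pi fun _ : Fin d => s)) :=
    (isCompact_stdSimplex ℝ (Fin d)).prod (isCompact_univ_pi fun _ => hs)
  have hcont : Continuous fun q : (Fin d → ℝ) × (Fin d → E) => ∑ i, q.1 i • q.2 i := by
    fun_prop
  convert hcpt.image hcont
  ext x
  constructor
  · intro hx
    obtain ⟨ι, _, z, w, hz, hind, hw, hw1, rfl⟩ := eq_pos_convex_span_of_mem_convexHull hx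
    have hcard : Fintype.card ι ≤ Fintype.card (Fin d) := by
      have := hind.card_le_finrank_succ
      have h2 := Submodule.finrank_le (vectorSpan ℝ (Set.range z))
      simp only [Fintype.card_fin, d]
      omega
    obtain ⟨f⟩ := Function.Embedding.nonempty_of_card_le hcard
    -- Slots not reached by `f` are padded with weight 0 and the dummy point `x₀`.
    refine ⟨(fun j => if h : ∃ i, f i = j then w h.choose else 0,
      fun j => if h : ∃ i, f i = j then z h.choose else x₀), ⟨⟨?_, ?_⟩, ?_⟩, ?_⟩
    · intro j
      dsimp only
      split_ifs
      exacts [(hw _).le, le_rfl]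
    · dsimp only
      rw [sum_eq_sum_comp_embedding f]
      · rw [← hw1]
        refine Finset.sum_congr rfl fun i _ => ?_
        have h : ∃ i', f i' = f i := ⟨i, rfl⟩
        rw [dif_pos h, f.injective h.choose_spec]
      · intro j hj
        exact dif_neg hj
    · intro j _
      dsimp only
      split_ifs
      exacts [hz ⟨_, rfl⟩, hx₀]
    · dsimp only
      rw [sum_eq_sum_comp_embedding f]
      · refine Finset.sum_congr rfl fun i _ => ?_
        have h : ∃ i', f i' = f i := ⟨i, rfl⟩
        rw [dif_pos h, dif_pos h, f.injective h.choose_spec]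
      · intro j hj
        have hj' : ¬ ∃ i, f i = j := hj
        rw [dif_neg hj', zero_smul]
  · rintro ⟨⟨w, z⟩, ⟨⟨hw, hw1⟩, hz⟩, rfl⟩
    exact (convex_convexHull ℝ s).sum_mem (fun i _ => hw i) hw1
      fun i _ => subset_convexHull ℝ s (hz i (Set.mem_univ i))

theorem isCompact_balancedHull {𝕜 E : Type*} [RCLike 𝕜] [NormedAddCommGroup E]
    [NormedSpace 𝕜 E] {s : Set E} (hs : IsCompact s) : IsCompact (balancedHull 𝕜 s) := by
  have : balancedHull 𝕜 s =
      (fun q : 𝕜 × E => q.1 • q.2) '' (Metric.closedBall (0 : 𝕜) 1 ×ˢ s) := by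
    ext x
    rw [mem_balancedHull_iff]
    constructor
    · rintro ⟨r, hr, y, hy, rfl⟩
      exact ⟨(r, y), ⟨by simpa using hr, hy⟩, rfl⟩
    · rintro ⟨⟨r, y⟩, ⟨hr, hy⟩, rfl⟩
      exact ⟨r, by simpa using hr, y, hy, rfl⟩
  rw [this]
  exact ((isCompact_closedBall _ _).prod hs).image continuous_smul

theorem convex_real_of_convex {𝕜 E : Type*} [RCLike 𝕜] [AddCommGroup E] [Module 𝕜 E]
    [Module ℝ E] [IsScalarTower ℝ 𝕜 E] {s : Set E} (hs : Convex 𝕜 s) : Convex ℝ s := by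
  intro x hx y hy a b ha hb hab
  have h := hs hx hy (a := (a : 𝕜)) (b := (b : 𝕜)) (by simpa using ha) (by simpa using hb)
    (by rw [← RCLike.ofReal_add, hab, RCLike.ofReal_one])
  have e : ∀ (c : ℝ) (v : E), (c : 𝕜) • v = c • v := fun c v => by
    rw [RCLike.ofReal_alg, smul_assoc, one_smul]
  rwa [e, e] at h

/-- A point at which every functional is bounded by `K` times its supremum over the compact set `s`
lies in `K` times the absolutely convex hull of `s`. -/
theorem mem_smul_absConvexHull_of_forall_le {𝕜 E : Type*} [RCLike 𝕜] [NormedAddCommGroup E]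
    [NormedSpace 𝕜 E] [NormedSpace ℝ E] [IsScalarTower ℝ 𝕜 E] [FiniteDimensional ℝ E]
    {s : Set E} (hs : IsCompact s) {K : ℝ} {x : E}
    (hx : ∀ f : StrongDual 𝕜 E, ∃ y ∈ s, ‖f x‖ ≤ K * ‖f y‖) :
    x ∈ K • absConvexHull 𝕜 s := by
  have e : ∀ (c : ℝ) (v : E), (c : 𝕜) • v = c • v := fun c v => by
    rw [RCLike.ofReal_alg, smul_assoc, one_smul]
  set T := convexHull ℝ (balancedHull 𝕜 s)
  have hT : IsCompact T := isCompact_convexHull_of_finiteDimensional (isCompact_balancedHull hs)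
  have hsub : T ⊆ absConvexHull 𝕜 s :=
    convexHull_min (balanced_absConvexHull.balancedHull_subset_of_subset subset_absConvexHull)
      (convex_real_of_convex convex_absConvexHull)
  refine Set.smul_set_mono hsub ?_
  by_contra hxT
  have hconv : Convex ℝ (K • T) := (convex_convexHull ℝ _).smul K
  obtain ⟨f, v, hlt, hv⟩ := RCLike.geometric_hahn_banach_closed_point (𝕜 := 𝕜) hconv
    (hT.smul K).isClosed hxT
  obtain ⟨y, hy, hxy⟩ := hx f
  -- The phase `c` rotates `f y` to its modulus; since `c • y` stays in the balanced hull, a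
  -- separating functional contradicts the bound at `y`.
  obtain ⟨c, hc, hcy⟩ : ∃ c : 𝕜, ‖c‖ ≤ 1 ∧ c * f y = (‖f y‖ : 𝕜) := by
    by_cases h0 : f y = 0
    · exact ⟨0, by simp, by simp [h0]⟩
    · refine ⟨(‖f y‖ : 𝕜) / f y, ?_, div_mul_cancel₀ _ h0⟩
      rw [norm_div, RCLike.norm_ofReal, abs_norm, div_self (by simpa using h0)]
  have hmem : K • c • y ∈ K • T := by
    refine Set.smul_mem_smul_set (subset_convexHull ℝ _ ?_)
    exact mem_balancedHull_iff.2 ⟨c, hc, Set.smul_mem_smul_set hy⟩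
  have h1 := hlt _ hmem
  rw [← e, f.map_smul, f.map_smul, smul_eq_mul, smul_eq_mul, hcy, ← RCLike.ofReal_mul,
    RCLike.ofReal_re] at h1
  have h2 := RCLike.re_le_norm (f x)
  linarith

end ConvexHull

/-! ### Rank-one correlation matrices. -/

section RankOne

variable {𝕜 : Type} [RCLike 𝕜] {k : ℕ}

theorem vecMulVec_mem_rankOneCorrelationMatrices (hk : 1 ≤ k) {p : Fin k → 𝕜}
    (hp : ∀ i, ‖p i‖ = 1) : vecMulVec p (star p) ∈ rankOneCorrelationMatrices 𝕜 k := by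
  have hd : ∀ i, vecMulVec p (star p) i i = 1 := fun i => by
    simp [vecMulVec_apply, RCLike.mul_conj, hp i]
  refine ⟨⟨posSemidef_vecMulVec_self_star p, hd⟩, le_antisymm (rank_vecMulVec_le _ _) ?_⟩
  rw [Nat.one_le_iff_ne_zero]
  intro h0
  have : vecMulVec p (star p) = 0 := by
    rw [rank_eq_finrank_span_cols, Submodule.finrank_eq_zero, Submodule.span_eq_bot] at h0
    ext i j
    exact congrFun (h0 _ ⟨j, rfl⟩) i
  have h1 := hd ⟨0, hk⟩
  rw [this] at h1
  simp at h1

theorem mem_rankOneCorrelationMatrices_iff (hk : 1 ≤ k) {T : Matrix (Fin k) (Fin k) 𝕜} :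
    T ∈ rankOneCorrelationMatrices 𝕜 k ↔
      ∃ p : Fin k → 𝕜, (∀ i, ‖p i‖ = 1) ∧ T = vecMulVec p (star p) := by
  constructor
  · rintro ⟨⟨hT, hd⟩, hr⟩
    set o : Fin k := ⟨0, hk⟩
    rw [rank_eq_finrank_span_cols] at hr
    let v : Submodule.span 𝕜 (Set.range T.col) := ⟨T.col o, Submodule.subset_span ⟨o, rfl⟩⟩
    have hv : v ≠ 0 := by
      intro h
      have := congrFun (congrArg Subtype.val h) o
      simp [v, hd] at this
    have hcol := (finrank_eq_one_iff_of_nonzero' v hv).1 hr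
    -- Column `j` is a multiple of column `o`; as `T o o = 1`, the factor is `T o j`, the conjugate
    -- of `T j o`.
    have hmul : ∀ i j, T i j = T i o * star (T j o) := by
      intro i j
      obtain ⟨c, hc⟩ := hcol ⟨T.col j, Submodule.subset_span ⟨j, rfl⟩⟩
      have hc' : ∀ i, c * T i o = T i j := fun i => congrFun (congrArg Subtype.val hc) i
      have h0 := hc' o
      rw [hd, mul_one] at h0
      rw [← hc' i, h0, mul_comm, ← hT.isHermitian.apply o j]
    refine ⟨fun i => T i o, fun i => ?_, ?_⟩
    · have h := hmul i i
      rw [hd, RCLike.star_def, RCLike.mul_conj] at h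
      have h2 : (‖T i o‖ : ℝ) ^ 2 = 1 := by exact_mod_cast h.symm
      exact (pow_eq_one_iff_of_nonneg (norm_nonneg _) two_ne_zero).1 h2
    · ext i j
      rw [hmul i j]
      rfl
  · rintro ⟨p, hp, rfl⟩
    exact vecMulVec_mem_rankOneCorrelationMatrices hk hp

theorem isCompact_rankOneCorrelationMatrices (hk : 1 ≤ k) :
    IsCompact (rankOneCorrelationMatrices 𝕜 k) := by
  have hc : IsCompact (Set.univ.pi fun _ : Fin k => Metric.sphere (0 : 𝕜) 1) :=
    isCompact_univ_pi fun _ => isCompact_sphere _ _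
  have hf : Continuous fun p : Fin k → 𝕜 => vecMulVec p (star p) := by
    refine continuous_matrix fun i j => ?_
    simp only [vecMulVec_apply, Pi.star_apply]
    fun_prop
  convert hc.image hf
  ext T
  rw [mem_rankOneCorrelationMatrices_iff hk]
  simp only [Set.mem_image, Set.mem_univ_pi, mem_sphere_zero_iff_norm]
  exact ⟨fun ⟨p, hp, h⟩ => ⟨p, hp, h.symm⟩, fun ⟨p, hp, h⟩ => ⟨p, hp, h.symm⟩⟩

theorem rankOneCorrelationMatrices_nonempty (hk : 1 ≤ k) :
    (rankOneCorrelationMatrices 𝕜 k).Nonempty :=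
  ⟨_, vecMulVec_mem_rankOneCorrelationMatrices hk (p := fun _ => 1) (by simp)⟩

theorem continuous_norm_trace (B : Matrix (Fin k) (Fin k) 𝕜) :
    Continuous fun T : Matrix (Fin k) (Fin k) 𝕜 => ‖(Bᴴ * T).trace‖ :=
  ((continuous_const.matrix_mul continuous_id).matrix_trace).norm

theorem trace_conjTranspose_mul (B T : Matrix (Fin k) (Fin k) 𝕜) :
    (Bᴴ * T).trace = ∑ i, ∑ j, star (B i j) * T i j := by
  simp only [trace, diag_apply, mul_apply, conjTranspose_apply]
  exact Finset.sum_comm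

theorem exists_isGreatest_rankOneValues (hk : 1 ≤ k) (B : Matrix (Fin k) (Fin k) 𝕜) :
    ∃ M, IsGreatest (rankOneValues B) M := by
  have : rankOneValues B = (fun T => ‖(Bᴴ * T).trace‖) '' rankOneCorrelationMatrices 𝕜 k := by
    ext t
    simp only [rankOneValues, Set.mem_ofPred_eq, Set.mem_image]
    exact ⟨fun ⟨T, hT, h⟩ => ⟨T, hT, h.symm⟩, fun ⟨T, hT, h⟩ => ⟨T, hT, h.symm⟩⟩
  rw [this]
  exact ((isCompact_rankOneCorrelationMatrices hk).image (continuous_norm_trace B)).exists_isGreatest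
    ((rankOneCorrelationMatrices_nonempty hk).image _)

theorem nonneg_of_isGreatest_rankOneValues {B : Matrix (Fin k) (Fin k) 𝕜} {M : ℝ}
    (hM : IsGreatest (rankOneValues B) M) : 0 ≤ M := by
  obtain ⟨T, -, h⟩ := hM.1
  rw [h]
  exact norm_nonneg _

end RankOne

/-! ### Reduction to one admissible constant and the inadmissibility of 1. -/

section Constants

variable {𝕜 : Type} [RCLike 𝕜]

/-- By compactness the maximum always exists and it is unique, so it may be quantified universally.
In this form admissibility is a family of closed conditions on `K`. -/
theorem isCorrelationBound_iff {K : ℝ} : IsCorrelationBound 𝕜 K ↔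
    ∀ k : ℕ, 1 ≤ k → ∀ (B : Matrix (Fin k) (Fin k) 𝕜) (M : ℝ), IsGreatest (rankOneValues B) M →
      ∀ S ∈ correlationMatrices 𝕜 k, ‖(Bᴴ * S).trace‖ ≤ K * M := by
  constructor
  · intro h k hk B M hM S hS
    obtain ⟨M', hM', hb⟩ := h k hk B
    rw [hM.unique hM']
    exact hb S hS
  · intro h k hk B
    obtain ⟨M, hM⟩ := exists_isGreatest_rankOneValues hk B
    exact ⟨M, hM, h k hk B M hM⟩

theorem IsCorrelationBound.mono {K L : ℝ} (h : IsCorrelationBound 𝕜 K) (hKL : K ≤ L) :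
    IsCorrelationBound 𝕜 L := by
  rw [isCorrelationBound_iff] at h ⊢
  intro k hk B M hM S hS
  exact (h k hk B M hM S hS).trans
    (mul_le_mul_of_nonneg_right hKL (nonneg_of_isGreatest_rankOneValues hM))

theorem isClosed_setOf_isCorrelationBound : IsClosed {K : ℝ | IsCorrelationBound 𝕜 K} := by
  have : {K : ℝ | IsCorrelationBound 𝕜 K} = ⋂ (k : ℕ) (_ : 1 ≤ k)
      (B : Matrix (Fin k) (Fin k) 𝕜) (M : ℝ) (_ : IsGreatest (rankOneValues B) M)
      (S : Matrix (Fin k) (Fin k) 𝕜) (_ : S ∈ correlationMatrices 𝕜 k),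
        {K : ℝ | ‖(Bᴴ * S).trace‖ ≤ K * M} := by
    ext K
    simp only [Set.mem_ofPred_eq, isCorrelationBound_iff, Set.mem_iInter]
  rw [this]
  refine isClosed_iInter fun k => isClosed_iInter fun _ => isClosed_iInter fun B =>
    isClosed_iInter fun M => isClosed_iInter fun _ => isClosed_iInter fun S =>
    isClosed_iInter fun _ => isClosed_le continuous_const (by fun_prop)

theorem IsCorrelationBound.one_le {K : ℝ} (h : IsCorrelationBound 𝕜 K) : 1 ≤ K := by
  rw [isCorrelationBound_iff] at h
  obtain ⟨M, hM⟩ := exists_isGreatest_rankOneValues le_rfl (1 : Matrix (Fin 1) (Fin 1) 𝕜)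
  obtain ⟨T, hT, hMT⟩ := hM.1
  have htr : (T.trace : 𝕜) = 1 := by simp [trace, hT.1.2]
  have hM1 : M = 1 := by simp [hMT, htr]
  have := h 1 le_rfl 1 M hM T hT.1
  simpa [htr, hM1] using this

theorem exists_isLeast_isCorrelationBound {K₀ : ℝ} (h : IsCorrelationBound 𝕜 K₀) :
    ∃ K, IsLeast {L : ℝ | IsCorrelationBound 𝕜 L} K := by
  have hb : BddBelow {L : ℝ | IsCorrelationBound 𝕜 L} := ⟨1, fun L hL => hL.one_le⟩
  exact ⟨_, isClosed_setOf_isCorrelationBound.csInf_mem ⟨K₀, h⟩ hb, fun L hL => csInf_le hb hL⟩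

theorem exists_matrix_of_strongDual {k : ℕ} (f : StrongDual 𝕜 (Fin k → Fin k → 𝕜)) :
    ∃ B : Matrix (Fin k) (Fin k) 𝕜, ∀ T : Fin k → Fin k → 𝕜,
      f T = (Bᴴ * Matrix.of T).trace := by
  refine ⟨Matrix.of fun i j => star (f (Pi.single i (Pi.single j 1))), fun T => ?_⟩
  rw [trace_conjTranspose_mul]
  have hT : T = ∑ i, ∑ j, T i j • Pi.single i (Pi.single j (1 : 𝕜)) := by
    ext a b
    simp [Finset.sum_apply, Pi.single_apply, Finset.sum_ite_eq, apply_ite, ite_apply]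
  conv_lhs => rw [hT]
  simp [map_sum, mul_comm]

theorem IsCorrelationBound.subset_smul_absConvexHull {K : ℝ} (h : IsCorrelationBound 𝕜 K) {k : ℕ}
    (hk : 1 ≤ k) : correlationMatrices 𝕜 k ⊆
      K • absConvexHull 𝕜 (rankOneCorrelationMatrices 𝕜 k) := by
  intro S hS
  refine mem_smul_absConvexHull_of_forall_le (E := Fin k → Fin k → 𝕜)
    (isCompact_rankOneCorrelationMatrices hk) fun f => ?_
  obtain ⟨B, hB⟩ := exists_matrix_of_strongDual f
  obtain ⟨M, hM⟩ := exists_isGreatest_rankOneValues hk B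
  obtain ⟨T, hT, hMT⟩ := hM.1
  refine ⟨T, hT, ?_⟩
  have h1 : ‖f T‖ = M := (congrArg norm (hB T)).trans hMT.symm
  rw [h1]
  exact (congrArg norm (hB S)).trans_le (isCorrelationBound_iff.1 h k hk B M hM S hS)

theorem bddAbove_unimodular_bilinear_values {m n : ℕ} (a : Matrix (Fin m) (Fin n) 𝕜) :
    BddAbove {t : ℝ | ∃ (p : Fin m → 𝕜) (q : Fin n → 𝕜),
      (∀ i, ‖p i‖ = 1) ∧ (∀ j, ‖q j‖ = 1) ∧ t = ‖∑ i, ∑ j, a i j * p i * q j‖} := by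
  refine ⟨∑ i, ∑ j, ‖a i j‖, ?_⟩
  rintro t ⟨p, q, hp, hq, rfl⟩
  refine (norm_sum_le _ _).trans (Finset.sum_le_sum fun i _ => (norm_sum_le _ _).trans
    (Finset.sum_le_sum fun j _ => ?_))
  simp [hp, hq]

/-- The Gram matrix of the `m + n` vectors is a correlation matrix whose upper right block contains
exactly the inner products of `x i` with `y j`. -/
theorem IsCorrelationBound.isGrothendieckBound {K : ℝ} (h : IsCorrelationBound 𝕜 K) :
    IsGrothendieckBound.{u} 𝕜 K := by
  have hK : 0 < K := zero_lt_one.trans_le h.one_le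
  refine ⟨hK, ?_⟩
  intro m n a H _ _ _ x y hx hy
  -- Admissibility says nothing about `k = 0`, so the empty system is treated apart.
  rcases Nat.eq_zero_or_pos (m + n) with h0 | hmn
  · obtain ⟨rfl, rfl⟩ : m = 0 ∧ n = 0 := by omega
    simp only [Finset.univ_eq_empty, Finset.sum_empty, norm_zero]
    refine mul_nonneg hK.le (Real.sSup_nonneg ?_)
    rintro t ⟨p, q, -, -, rfl⟩
    rfl
  let v : Fin (m + n) → H := Fin.append x y
  have hS : gram 𝕜 v ∈ correlationMatrices 𝕜 (m + n) := by
    refine ⟨posSemidef_gram 𝕜 v, fun i => ?_⟩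
    have hv : ‖v i‖ = 1 := by
      refine Fin.addCases (fun i => ?_) (fun j => ?_) i
      · simp [v, hx]
      · simp [v, hy]
    rw [gram_apply, inner_self_eq_norm_sq_to_K, hv]
    simp
  -- The conjugate undoes the adjoint in `Bᴴ`, and the zero blocks erase all other inner products.
  let B : Matrix (Fin (m + n)) (Fin (m + n)) 𝕜 := fun i j =>
    Fin.addCases (fun i => Fin.addCases (fun _ => 0) (fun j => star (a i j)) j) (fun _ => 0) i
  have hB : ∀ T : Matrix (Fin (m + n)) (Fin (m + n)) 𝕜, (Bᴴ * T).trace =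
      ∑ i, ∑ j, a i j * T (Fin.castAdd n i) (Fin.natAdd m j) := by
    intro T
    rw [trace_conjTranspose_mul, Fin.sum_univ_add]
    simp [B, Fin.sum_univ_add]
  obtain ⟨M, hM⟩ := exists_isGreatest_rankOneValues hmn B
  have h1 := isCorrelationBound_iff.1 h _ hmn B M hM _ hS
  rw [hB] at h1
  simp only [gram_apply, v, Fin.append_left, Fin.append_right] at h1
  refine h1.trans (mul_le_mul_of_nonneg_left ?_ hK.le)
  obtain ⟨T, hT, rfl⟩ := hM.1
  obtain ⟨p, hp, rfl⟩ := (mem_rankOneCorrelationMatrices_iff hmn).1 hT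
  refine le_csSup (bddAbove_unimodular_bilinear_values a)
    ⟨fun i => p (Fin.castAdd n i), fun j => star (p (Fin.natAdd m j)), fun i => hp _,
      fun j => by rw [norm_star]; exact hp _, ?_⟩
  rw [hB]
  simp [vecMulVec_apply, mul_assoc]

theorem IsGrothendieckBound.one_le {K : ℝ} (h : IsGrothendieckBound.{u} 𝕜 K) : 1 ≤ K := by
  have h1 := h.2 1 1 1 (EuclideanSpace 𝕜 (ULift.{u} (Fin 1)))
    (fun _ => EuclideanSpace.single ⟨0⟩ 1) (fun _ => EuclideanSpace.single ⟨0⟩ 1)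
    (by simp) (by simp)
  have hset : {t : ℝ | ∃ (p : Fin 1 → 𝕜) (q : Fin 1 → 𝕜), (∀ i, ‖p i‖ = 1) ∧ (∀ j, ‖q j‖ = 1) ∧
      t = ‖∑ i, ∑ j, (1 : Matrix (Fin 1) (Fin 1) 𝕜) i j * p i * q j‖} = {1} := by
    ext t
    simp only [Set.mem_ofPred_eq, Set.mem_singleton_iff]
    constructor
    · rintro ⟨p, q, hp, hq, rfl⟩
      simp [hp, hq]
    · rintro rfl
      exact ⟨fun _ => 1, fun _ => 1, by simp, by simp, by simp⟩
  rw [hset, csSup_singleton] at h1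
  simpa using h1

theorem isLeast_grothendieckConstant {K₀ : ℝ} (h : IsGrothendieckBound.{u} 𝕜 K₀) :
    IsLeast {K : ℝ | IsGrothendieckBound.{u} 𝕜 K} (grothendieckConstant.{u} 𝕜) := by
  have hb : BddBelow {K : ℝ | IsGrothendieckBound.{u} 𝕜 K} := ⟨1, fun L hL => hL.one_le⟩
  have h1 : 1 ≤ grothendieckConstant.{u} 𝕜 := le_csInf ⟨K₀, h⟩ fun L hL => hL.one_le
  refine ⟨⟨zero_lt_one.trans_le h1, ?_⟩, fun L hL => csInf_le hb hL⟩
  intro m n a H _ _ _ x y hx hy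
  set s := sSup {t : ℝ | ∃ (p : Fin m → 𝕜) (q : Fin n → 𝕜),
        (∀ i, ‖p i‖ = 1) ∧ (∀ j, ‖q j‖ = 1) ∧ t = ‖∑ i, ∑ j, a i j * p i * q j‖} with hs
  have hs0 : 0 ≤ s := by
    refine Real.sSup_nonneg ?_
    rintro t ⟨p, q, -, -, rfl⟩
    exact norm_nonneg _
  have hall : ∀ L, IsGrothendieckBound.{u} 𝕜 L →
      ‖∑ i, ∑ j, a i j * inner 𝕜 (x i) (y j)‖ ≤ L * s := fun L hL => hL.2 m n a H x y hx hy
  -- For a vanishing supremum any one admissible constant forces the left side to be 0; otherwise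
  -- division by `s` passes to the infimum.
  rcases hs0.eq_or_lt with h0 | hpos
  · have := hall K₀ h
    rw [← h0, mul_zero] at this ⊢
    exact this
  · rw [← div_le_iff₀ hpos]
    refine le_csInf ⟨K₀, h⟩ fun L hL => ?_
    rw [div_le_iff₀ hpos]
    exact hall L hL

/-- Everything about the constants follows from one admissible constant `K₀` and the
inadmissibility of `1`. -/
theorem constants_of_isCorrelationBound {K₀ : ℝ} (h : IsCorrelationBound 𝕜 K₀)
    (h1 : ¬ IsCorrelationBound 𝕜 1) :
    IsLeast {K : ℝ | IsGrothendieckBound.{u} 𝕜 K} (grothendieckConstant.{u} 𝕜) ∧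
      ∃ K : ℝ, 1 < K ∧ IsLeast {L : ℝ | IsCorrelationBound 𝕜 L} K ∧
        (∀ k : ℕ, 1 ≤ k → correlationMatrices 𝕜 k ⊆
          K • absConvexHull 𝕜 (rankOneCorrelationMatrices 𝕜 k)) ∧
        K ∈ Set.Icc (grothendieckConstant.{u} 𝕜) K₀ := by
  have hG := isLeast_grothendieckConstant.{u} h.isGrothendieckBound
  obtain ⟨K, hK⟩ := exists_isLeast_isCorrelationBound h
  have hKb : IsCorrelationBound 𝕜 K := hK.1
  refine ⟨hG, K, ?_, hK, fun k hk => hKb.subset_smul_absConvexHull hk,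
    hG.2 hKb.isGrothendieckBound, hK.2 h⟩
  refine lt_of_le_of_ne hKb.one_le ?_
  rintro rfl
  exact h1 hKb

end Constants

end Grothendieck

namespace Grothendieck

open Matrix MeasureTheory

/-! ### The hull R and its stability properties. -/

section RoundedHull

variable {𝕜 : Type} [RCLike 𝕜] {k : ℕ}

/-- The closed convex hull of the correlation matrices of rank one, consisting of the matrices
`E[u_i conj(u_j)]` for random unimodular vectors `u`. -/
def roundedMatrices (𝕜 : Type) [RCLike 𝕜] (k : ℕ) : Set (Matrix (Fin k) (Fin k) 𝕜) :=
  closure (convexHull ℝ (rankOneCorrelationMatrices 𝕜 k))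

theorem isClosed_roundedMatrices : IsClosed (roundedMatrices 𝕜 k) := isClosed_closure

theorem convex_roundedMatrices : Convex ℝ (roundedMatrices 𝕜 k) :=
  (convex_convexHull ℝ _).closure

theorem rankOneCorrelationMatrices_subset_roundedMatrices :
    rankOneCorrelationMatrices 𝕜 k ⊆ roundedMatrices 𝕜 k :=
  (subset_convexHull ℝ _).trans subset_closure

theorem roundedMatrices_subset {s : Set (Matrix (Fin k) (Fin k) 𝕜)} (hs : IsClosed s)
    (hc : Convex ℝ s) (h : rankOneCorrelationMatrices 𝕜 k ⊆ s) : roundedMatrices 𝕜 k ⊆ s :=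
  closure_minimal (convexHull_min h hc) hs

theorem norm_trace_le_of_mem_roundedMatrices {B X : Matrix (Fin k) (Fin k) 𝕜} {M : ℝ}
    (hM : IsGreatest (rankOneValues B) M) (hX : X ∈ roundedMatrices 𝕜 k) :
    ‖(Bᴴ * X).trace‖ ≤ M := by
  have hconv : Convex ℝ {X : Matrix (Fin k) (Fin k) 𝕜 | ‖(Bᴴ * X).trace‖ ≤ M} := by
    intro X hX Y hY a b ha hb hab
    simp only [Set.mem_ofPred_eq] at hX hY ⊢
    calc ‖(Bᴴ * (a • X + b • Y)).trace‖
        = ‖a • (Bᴴ * X).trace + b • (Bᴴ * Y).trace‖ := by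
          rw [Matrix.mul_add, Matrix.mul_smul, Matrix.mul_smul, trace_add, trace_smul, trace_smul]
      _ ≤ a * M + b * M := by
          refine (norm_add_le _ _).trans ?_
          rw [norm_smul, norm_smul, Real.norm_of_nonneg ha, Real.norm_of_nonneg hb]
          gcongr
      _ = M := by rw [← add_mul, hab, one_mul]
  refine roundedMatrices_subset (isClosed_le (continuous_norm_trace B) continuous_const) hconv
    (fun T hT => hM.2 ⟨T, hT, rfl⟩) hX

theorem hadamard_mem_rankOneCorrelationMatrices (hk : 1 ≤ k) {S T : Matrix (Fin k) (Fin k) 𝕜}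
    (hS : S ∈ rankOneCorrelationMatrices 𝕜 k) (hT : T ∈ rankOneCorrelationMatrices 𝕜 k) :
    S ⊙ T ∈ rankOneCorrelationMatrices 𝕜 k := by
  rw [mem_rankOneCorrelationMatrices_iff hk] at hS hT ⊢
  obtain ⟨p, hp, rfl⟩ := hS
  obtain ⟨q, hq, rfl⟩ := hT
  refine ⟨fun i => p i * q i, fun i => by simp [hp, hq], ?_⟩
  ext i j
  simp [vecMulVec_apply]
  ring

/-- Entrywise products of rank-one correlation matrices are again such. Multiplication by a fixed
matrix is linear and continuous, so this extends to the closed hull in one factor and then in the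
other. -/
theorem hadamard_mem_roundedMatrices (hk : 1 ≤ k) {X Y : Matrix (Fin k) (Fin k) 𝕜}
    (hX : X ∈ roundedMatrices 𝕜 k) (hY : Y ∈ roundedMatrices 𝕜 k) :
    X ⊙ Y ∈ roundedMatrices 𝕜 k := by
  have hcontl : ∀ T : Matrix (Fin k) (Fin k) 𝕜, Continuous fun Z => T ⊙ Z := fun T =>
    continuous_matrix fun i j => by
      simp only [hadamard_apply]
      exact continuous_const.mul (continuous_id.matrix_elem i j)
  have hcontr : ∀ T : Matrix (Fin k) (Fin k) 𝕜, Continuous fun Z => Z ⊙ T := fun T =>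
    continuous_matrix fun i j => by
      simp only [hadamard_apply]
      exact (continuous_id.matrix_elem i j).mul continuous_const
  have h1 : ∀ T ∈ rankOneCorrelationMatrices 𝕜 k, T ⊙ Y ∈ roundedMatrices 𝕜 k := by
    intro T hT
    have : roundedMatrices 𝕜 k ⊆ (fun Z => T ⊙ Z) ⁻¹' roundedMatrices 𝕜 k := by
      refine roundedMatrices_subset (isClosed_roundedMatrices.preimage (hcontl T)) ?_ ?_
      · intro A hA B hB a b ha hb hab
        simp only [Set.mem_preimage, hadamard_add, hadamard_smul] at hA hB ⊢
        exact convex_roundedMatrices hA hB ha hb hab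
      · exact fun S hS => rankOneCorrelationMatrices_subset_roundedMatrices
          (hadamard_mem_rankOneCorrelationMatrices hk hT hS)
    exact this hY
  have : roundedMatrices 𝕜 k ⊆ (fun Z => Z ⊙ Y) ⁻¹' roundedMatrices 𝕜 k := by
    refine roundedMatrices_subset (isClosed_roundedMatrices.preimage (hcontr Y)) ?_ h1
    intro A hA B hB a b ha hb hab
    simp only [Set.mem_preimage, add_hadamard, smul_hadamard] at hA hB ⊢
    exact convex_roundedMatrices hA hB ha hb hab
  exact this hX

theorem map_star_mem_roundedMatrices (hk : 1 ≤ k) {X : Matrix (Fin k) (Fin k) 𝕜}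
    (hX : X ∈ roundedMatrices 𝕜 k) : X.map star ∈ roundedMatrices 𝕜 k := by
  have : roundedMatrices 𝕜 k ⊆ (fun Z => Z.map star) ⁻¹' roundedMatrices 𝕜 k := by
    refine roundedMatrices_subset (isClosed_roundedMatrices.preimage
      (continuous_id.matrix_map continuous_star)) ?_ ?_
    · intro A hA B hB a b ha hb hab
      have e : (a • A + b • B).map (star : 𝕜 → 𝕜) = a • A.map star + b • B.map star := by
        ext i j
        simp [RCLike.real_smul_eq_coe_mul]
      simp only [Set.mem_preimage, e] at hA hB ⊢
      exact convex_roundedMatrices hA hB ha hb hab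
    · intro T hT
      refine rankOneCorrelationMatrices_subset_roundedMatrices ?_
      obtain ⟨p, hp, rfl⟩ := (mem_rankOneCorrelationMatrices_iff hk).1 hT
      refine (mem_rankOneCorrelationMatrices_iff hk).2 ⟨star p, fun i => by simp [hp], ?_⟩
      ext i j
      simp [vecMulVec_apply, mul_comm]
  exact this hX

theorem one_mem_roundedMatrices (hk : 1 ≤ k) :
    (Matrix.of fun _ _ => 1 : Matrix (Fin k) (Fin k) 𝕜) ∈ roundedMatrices 𝕜 k := by
  refine rankOneCorrelationMatrices_subset_roundedMatrices
    ((mem_rankOneCorrelationMatrices_iff hk).2 ⟨fun _ => 1, by simp, ?_⟩)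
  ext i j
  simp [vecMulVec_apply]

/-- Expectations of random rank-one correlation matrices are rounded matrices. -/
theorem of_integral_mem_roundedMatrices (hk : 1 ≤ k) {Ω : Type*} [MeasurableSpace Ω]
    (μ : Measure Ω) [IsProbabilityMeasure μ] {p : Ω → Fin k → 𝕜} (hp : ∀ i, ∀ᵐ ω ∂μ, ‖p ω i‖ = 1)
    (hm : ∀ i, Measurable fun ω => p ω i) :
    (Matrix.of fun i j => ∫ ω, p ω i * star (p ω j) ∂μ) ∈ roundedMatrices 𝕜 k := by
  have hInt : ∀ i j, Integrable (fun ω => p ω i * star (p ω j)) μ := fun i j =>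
    Integrable.of_bound ((hm i).mul (continuous_star.measurable.comp (hm j))).aestronglyMeasurable 1
      (by filter_upwards [hp i, hp j] with ω h1 h2 using by simp [h1, h2])
  have hint2 : Integrable (fun ω => (fun i j => p ω i * star (p ω j) : Fin k → Fin k → 𝕜)) μ :=
    Integrable.of_eval fun i => Integrable.of_eval fun j => hInt i j
  have hmem : ∫ ω, (fun i j => p ω i * star (p ω j) : Fin k → Fin k → 𝕜) ∂μ ∈
      (roundedMatrices 𝕜 k : Set (Fin k → Fin k → 𝕜)) := by
    refine Convex.integral_mem (E := Fin k → Fin k → 𝕜) convex_roundedMatrices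
      isClosed_roundedMatrices ?_ hint2
    filter_upwards [ae_all_iff.2 hp] with ω hω
    exact rankOneCorrelationMatrices_subset_roundedMatrices
      ((mem_rankOneCorrelationMatrices_iff hk).2 ⟨p ω, hω, rfl⟩)
  have e : (fun i j => ∫ ω, p ω i * star (p ω j) ∂μ : Fin k → Fin k → 𝕜) =
      ∫ ω, (fun i j => p ω i * star (p ω j) : Fin k → Fin k → 𝕜) ∂μ := by
    ext i j
    rw [eval_integral (fun i => hint2.eval i), eval_integral (fun j => (hint2.eval i).eval j)]
  rw [← e] at hmem
  exact hmem

end RoundedHull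

end Grothendieck

namespace Grothendieck

open Matrix MeasureTheory ProbabilityTheory
open scoped RealInnerProductSpace

/-! ### Laws of pairs of Gaussian functionals. -/

section PairLaw

variable {E F : Type*} [NormedAddCommGroup E] [InnerProductSpace ℝ E] [FiniteDimensional ℝ E]
  [MeasurableSpace E] [BorelSpace E] [NormedAddCommGroup F] [InnerProductSpace ℝ F]
  [FiniteDimensional ℝ F] [MeasurableSpace F] [BorelSpace F]

theorem charFunDual_stdGaussian_of_inner {L : StrongDual ℝ E} {v : E} (h : ∀ x, L x = ⟪v, x⟫) :
    charFunDual (stdGaussian E) L = Complex.exp (-(‖v‖ ^ 2 : ℝ) / 2) := by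
  have : L = innerSL ℝ v := by
    ext x
    rw [h x, innerSL_apply_apply]
  rw [charFunDual_stdGaussian, this, innerSL_apply_norm]
  push_cast
  rfl

/-- Two linear images of a standard Gaussian vector have the joint law of `(W, A W + σ W')` with
independent standard Gaussian `W`, `W'`, as soon as the covariances agree. -/
theorem map_prodMk_stdGaussian (T₁ T₂ : E →L[ℝ] F) (A : F →L[ℝ] F) (σ : ℝ) (S₁ S₂ : F → E)
    (A' : F → F) (h₁ : ∀ t x, ⟪t, T₁ x⟫ = ⟪S₁ t, x⟫) (h₂ : ∀ t x, ⟪t, T₂ x⟫ = ⟪S₂ t, x⟫)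
    (hA : ∀ t x, ⟪t, A x⟫ = ⟪A' t, x⟫)
    (h : ∀ s t, ‖S₁ s + S₂ t‖ ^ 2 = ‖s + A' t‖ ^ 2 + σ ^ 2 * ‖t‖ ^ 2) :
    (stdGaussian E).map (fun x => (T₁ x, T₂ x)) =
      ((stdGaussian F).prod (stdGaussian F)).map (fun w => (w.1, A w.1 + σ • w.2)) := by
  have : FiniteDimensional ℝ (F × F) := inferInstance
  let T : E →L[ℝ] F × F := T₁.prod T₂
  let R : F × F →L[ℝ] F × F := (ContinuousLinearMap.fst ℝ F F).prod
    (A.comp (ContinuousLinearMap.fst ℝ F F) + σ • ContinuousLinearMap.snd ℝ F F)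
  change (stdGaussian E).map T = ((stdGaussian F).prod (stdGaussian F)).map R
  have : IsProbabilityMeasure ((stdGaussian E).map T) :=
    Measure.isProbabilityMeasure_map T.continuous.aemeasurable
  have : IsProbabilityMeasure (((stdGaussian F).prod (stdGaussian F)).map R) :=
    Measure.isProbabilityMeasure_map R.continuous.aemeasurable
  -- A functional on the product is a pair `(s, t)`; both laws are centred Gaussian, so only the
  -- variances equated in `h` have to agree.
  apply Measure.ext_of_charFunDual
  ext L
  set s := (InnerProductSpace.toDual ℝ F).symm (L.comp (ContinuousLinearMap.inl ℝ F F))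
  set t := (InnerProductSpace.toDual ℝ F).symm (L.comp (ContinuousLinearMap.inr ℝ F F))
  have hL : ∀ a b, L (a, b) = ⟪s, a⟫ + ⟪t, b⟫ := by
    intro a b
    simp only [s, t, InnerProductSpace.toDual_symm_apply]
    simp [← map_add]
  rw [charFunDual_map, charFunDual_map, charFunDual_prod,
    charFunDual_stdGaussian_of_inner (v := S₁ s + S₂ t),
    charFunDual_stdGaussian_of_inner (v := s + A' t),
    charFunDual_stdGaussian_of_inner (v := σ • t), ← Complex.exp_add, h, norm_smul, mul_pow]
  · congr 1
    rw [Real.norm_eq_abs, sq_abs]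
    push_cast
    ring
  · intro x
    simp only [ContinuousLinearMap.comp_apply, ContinuousLinearMap.inr_apply]
    change L ((0 : F), A 0 + σ • x) = _
    rw [map_zero, zero_add, hL, inner_zero_right, zero_add, real_inner_smul_right,
      real_inner_smul_left]
  · intro x
    simp only [ContinuousLinearMap.comp_apply, ContinuousLinearMap.inl_apply]
    change L (x, A x + σ • (0 : F)) = _
    rw [smul_zero, add_zero, hL, hA, inner_add_left]
  · intro x
    change L (T₁ x, T₂ x) = _
    rw [hL, h₁, h₂, inner_add_left]

theorem stdGaussian_real : stdGaussian ℝ = gaussianReal 0 1 := by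
  apply Measure.ext_of_charFun
  ext t
  rw [charFun_stdGaussian, charFun_gaussianReal]
  congr 1
  simp [neg_div, ← Complex.ofReal_pow]

theorem stdGaussian_complex : stdGaussian ℂ =
    ((gaussianReal 0 1).prod (gaussianReal 0 1)).map (fun q => (q.1 : ℂ) + q.2 * Complex.I) := by
  have hm : Measurable fun q : ℝ × ℝ => (q.1 : ℂ) + q.2 * Complex.I := by fun_prop
  have : IsProbabilityMeasure (((gaussianReal 0 1).prod (gaussianReal 0 1)).map
      (fun q : ℝ × ℝ => (q.1 : ℂ) + q.2 * Complex.I)) :=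
    Measure.isProbabilityMeasure_map hm.aemeasurable
  apply Measure.ext_of_charFun
  ext t
  rw [charFun_stdGaussian, charFun_apply, integral_map hm.aemeasurable (by fun_prop)]
  have : ∀ q : ℝ × ℝ, Complex.exp (⟪(q.1 : ℂ) + q.2 * Complex.I, t⟫ * Complex.I) =
      Complex.exp (t.re * q.1 * Complex.I) * Complex.exp (t.im * q.2 * Complex.I) := by
    intro q
    rw [← Complex.exp_add]
    congr 1
    simp [Complex.inner]
    ring
  simp_rw [this]
  rw [integral_prod_mul (fun x : ℝ => Complex.exp (t.re * x * Complex.I))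
    (fun x : ℝ => Complex.exp (t.im * x * Complex.I)), ← charFun_apply_real,
    ← charFun_apply_real, charFun_gaussianReal, charFun_gaussianReal, ← Complex.exp_add]
  congr 1
  rw [← Complex.ofReal_pow, ← Complex.normSq_eq_norm_sq, Complex.normSq_apply]
  push_cast
  simp
  ring

end PairLaw

section Sign

/-- The value `w / |w|` (and `0` at `0`). -/
noncomputable def unimodularSign {𝕜 : Type} [RCLike 𝕜] (w : 𝕜) : 𝕜 := (‖w‖⁻¹ : ℝ) * w

theorem measurable_unimodularSign {𝕜 : Type} [RCLike 𝕜] : Measurable (unimodularSign (𝕜 := 𝕜)) := by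
  unfold unimodularSign
  exact (RCLike.measurable_ofReal.comp measurable_norm.inv).mul measurable_id

theorem norm_unimodularSign {𝕜 : Type} [RCLike 𝕜] {w : 𝕜} (hw : w ≠ 0) : ‖unimodularSign w‖ = 1 := by
  simp [unimodularSign, hw]

theorem norm_unimodularSign_le {𝕜 : Type} [RCLike 𝕜] (w : 𝕜) : ‖unimodularSign w‖ ≤ 1 := by
  by_cases hw : w = 0
  · simp [unimodularSign, hw]
  · exact (norm_unimodularSign hw).le

end Sign

end Grothendieck

/-! ### Grothendieck's identity for real Gaussian signs. -/

namespace Grothendieck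

open Matrix MeasureTheory ProbabilityTheory
open scoped RealInnerProductSpace

open scoped MatrixOrder Matrix.Norms.L2Operator in
theorem exists_gram_eq {𝕜 : Type} [RCLike 𝕜] {k : ℕ} {S : Matrix (Fin k) (Fin k) 𝕜}
    (hS : S.PosSemidef) :
    ∃ v : Fin k → EuclideanSpace 𝕜 (Fin k), ∀ i j, inner 𝕜 (v i) (v j) = S i j := by
  obtain ⟨B, rfl⟩ := CStarAlgebra.nonneg_iff_eq_star_mul_self.mp hS.nonneg
  refine ⟨fun i => WithLp.toLp 2 (B.col i), fun i j => ?_⟩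
  simp [PiLp.inner_apply, star_eq_conjTranspose, mul_apply, mul_comm]

section RealSign

theorem integrable_abs_mul_exp_neg_mul_sq {b : ℝ} (hb : 0 < b) :
    Integrable fun x : ℝ => |x| * Real.exp (-b * x ^ 2) := by
  have := (integrable_mul_exp_neg_mul_sq hb).norm
  simpa [abs_mul] using this

theorem integral_abs_mul_exp_neg_mul_sq {b : ℝ} (hb : 0 < b) :
    ∫ x : ℝ, |x| * Real.exp (-b * x ^ 2) = 1 / b := by
  have h1 : ∀ x : ℝ, |x| * Real.exp (-b * x ^ 2) = |x| * Real.exp (-b * |x| ^ 2) := by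
    intro x
    rw [sq_abs]
  simp_rw [h1]
  rw [integral_comp_abs (f := fun x => x * Real.exp (-b * x ^ 2))]
  have hd : ∀ x ∈ Set.Ici (0 : ℝ),
      HasDerivAt (fun x => -(1 / (2 * b)) * Real.exp (-b * x ^ 2)) (x * Real.exp (-b * x ^ 2)) x := by
    intro x _
    have := (((hasDerivAt_pow 2 x).const_mul (-b)).exp).const_mul (-(1 / (2 * b)))
    refine this.congr_deriv ?_
    simp only [Nat.cast_ofNat, Nat.add_one_sub_one, pow_one]
    field_simp
  have hlim : Filter.Tendsto (fun x => -(1 / (2 * b)) * Real.exp (-b * x ^ 2)) Filter.atTop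
      (nhds 0) := by
    have : Filter.Tendsto (fun x : ℝ => -b * x ^ 2) Filter.atTop Filter.atBot :=
      (Filter.tendsto_pow_atTop two_ne_zero).const_mul_atTop_of_neg (by linarith)
    simpa using (Real.tendsto_exp_atBot.comp this).const_mul (-(1 / (2 * b)))
  rw [integral_Ioi_of_hasDerivAt_of_tendsto' hd (integrable_mul_exp_neg_mul_sq hb).integrableOn hlim]
  simp
  field_simp

theorem unimodularSign_mul_unimodularSign_mul {x : ℝ} (hx : x ≠ 0) (y : ℝ) :
    unimodularSign x * unimodularSign (x * y) = unimodularSign y := by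
  have h := abs_ne_zero.2 hx
  simp only [unimodularSign, RCLike.ofReal_real_eq_id, id_eq, Real.norm_eq_abs, abs_mul, mul_inv]
  have : |x|⁻¹ * |x|⁻¹ * (x * x) = 1 := by
    rw [← abs_mul_abs_self x]
    field_simp
  linear_combination |y|⁻¹ * y * this

theorem unimodularSign_real_of_pos {x : ℝ} (hx : 0 < x) : unimodularSign x = 1 := by
  simp [unimodularSign, abs_of_pos hx, hx.ne']

theorem unimodularSign_real_of_neg {x : ℝ} (hx : x < 0) : unimodularSign x = -1 := by
  simp [unimodularSign, abs_of_neg hx, hx.ne, inv_neg]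

/-- The sign jumps at `-(ρ / σ)`, and the two arctangent tails on either side are subtracted. -/
theorem integral_unimodularSign_add_mul_div {ρ σ : ℝ} (hσ : 0 < σ) :
    ∫ t : ℝ, unimodularSign (ρ + σ * t) * (1 + t ^ 2)⁻¹ = 2 * Real.arctan (ρ / σ) := by
  set t₀ := -(ρ / σ) with ht₀
  have hInt : Integrable fun t : ℝ => unimodularSign (ρ + σ * t) * (1 + t ^ 2)⁻¹ := by
    refine integrable_inv_one_add_sq.bdd_mul (c := 1) ?_ ?_
    · exact (measurable_unimodularSign.comp (by fun_prop)).aestronglyMeasurable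
    · exact Filter.Eventually.of_forall fun t => norm_unimodularSign_le _
  rw [← intervalIntegral.integral_Iio_add_Ici (b := t₀) hInt.integrableOn hInt.integrableOn,
    integral_Ici_eq_integral_Ioi]
  have e1 : ∫ t in Set.Iio t₀, unimodularSign (ρ + σ * t) * (1 + t ^ 2)⁻¹ =
      ∫ t in Set.Iio t₀, -(1 + t ^ 2)⁻¹ := by
    refine setIntegral_congr_fun measurableSet_Iio fun t ht => ?_
    have : ρ + σ * t < 0 := by
      have h : t < -(ρ / σ) := ht
      have := mul_lt_mul_of_pos_left h hσ
      rw [mul_neg, mul_div_cancel₀ _ hσ.ne'] at this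
      linarith
    simp [unimodularSign_real_of_neg this]
  have e2 : ∫ t in Set.Ioi t₀, unimodularSign (ρ + σ * t) * (1 + t ^ 2)⁻¹ =
      ∫ t in Set.Ioi t₀, (1 + t ^ 2)⁻¹ := by
    refine setIntegral_congr_fun measurableSet_Ioi fun t ht => ?_
    have : 0 < ρ + σ * t := by
      have h : -(ρ / σ) < t := ht
      have := mul_lt_mul_of_pos_left h hσ
      rw [mul_neg, mul_div_cancel₀ _ hσ.ne'] at this
      linarith
    simp [unimodularSign_real_of_pos this]
  rw [e1, e2, integral_neg, ← integral_Iic_eq_integral_Iio, integral_Iic_inv_one_add_sq,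
    integral_Ioi_inv_one_add_sq, ht₀, Real.arctan_neg]
  ring

theorem ae_ne_zero_gaussianReal : ∀ᵐ x ∂(gaussianReal 0 1), x ≠ 0 := by
  have := nullSingletonClass_gaussianReal (μ := 0) one_ne_zero
  simp [ae_iff]

/-- The product of signs depends only on the ratio t = y / x, which is Cauchy distributed:
substituting y = x t and integrating out x leaves the sign of ρ + σ t against 1 / (π (1 + t²)). -/
theorem integral_integral_unimodularSign {ρ σ : ℝ} (hσ₀ : 0 ≤ σ) (h : ρ ^ 2 + σ ^ 2 = 1) :
    ∫ x, ∫ y, unimodularSign x * unimodularSign (ρ * x + σ * y) ∂(gaussianReal 0 1)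
      ∂(gaussianReal 0 1) = 2 / Real.pi * Real.arcsin ρ := by
  -- For σ = 0 one has ρ = ±1, and the second sign is ± the first.
  rcases hσ₀.eq_or_lt with rfl | hσ
  · have hsign : 2 / Real.pi * Real.arcsin ρ = unimodularSign ρ := by
      have hρ : ρ = 1 ∨ ρ = -1 := by
        have : (ρ - 1) * (ρ + 1) = 0 := by linear_combination h
        rcases mul_eq_zero.1 this with h1 | h1
        · left; linarith
        · right; linarith
      rcases hρ with rfl | rfl
      · rw [Real.arcsin_one, unimodularSign_real_of_pos one_pos]
        field_simp
      · rw [Real.arcsin_neg_one, unimodularSign_real_of_neg (by norm_num)]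
        field_simp
    simp only [zero_mul, add_zero, integral_const, probReal_univ, smul_eq_mul, one_mul, hsign]
    rw [integral_congr_ae (g := fun _ => unimodularSign ρ)]
    · simp
    · filter_upwards [ae_ne_zero_gaussianReal] with x hx
      rw [mul_comm ρ x, unimodularSign_mul_unimodularSign_mul hx]
  have hpdf : ∀ x : ℝ, gaussianPDFReal 0 1 x = (√(2 * Real.pi))⁻¹ * Real.exp (-x ^ 2 / 2) := by
    intro x
    simp [gaussianPDFReal]
  have hsq : (√(2 * Real.pi))⁻¹ * (√(2 * Real.pi))⁻¹ = 1 / (2 * Real.pi) := by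
    rw [← mul_inv, Real.mul_self_sqrt (by positivity), one_div]
  simp_rw [integral_gaussianReal_eq_integral_smul (μ := 0) one_ne_zero, smul_eq_mul]
  have hinner : ∀ x : ℝ, x ≠ 0 →
      gaussianPDFReal 0 1 x * ∫ y, gaussianPDFReal 0 1 y *
        (unimodularSign x * unimodularSign (ρ * x + σ * y)) =
      ∫ t, unimodularSign (ρ + σ * t) *
        (1 / (2 * Real.pi) * (|x| * Real.exp (-((1 + t ^ 2) / 2) * x ^ 2))) := by
    intro x hx
    have hsub := Measure.integral_comp_mul_left (fun y => gaussianPDFReal 0 1 y *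
        (unimodularSign x * unimodularSign (ρ * x + σ * y))) x
    rw [smul_eq_mul, abs_inv] at hsub
    have : ∫ y, gaussianPDFReal 0 1 y * (unimodularSign x * unimodularSign (ρ * x + σ * y)) =
        |x| * ∫ t, gaussianPDFReal 0 1 (x * t) *
          (unimodularSign x * unimodularSign (ρ * x + σ * (x * t))) := by
      rw [hsub, mul_inv_cancel_left₀ (abs_ne_zero.2 hx)]
    rw [this, ← mul_assoc, ← integral_const_mul]
    refine integral_congr_ae (Filter.Eventually.of_forall fun t => ?_)
    simp only
    rw [show ρ * x + σ * (x * t) = x * (ρ + σ * t) by ring,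
      unimodularSign_mul_unimodularSign_mul hx, hpdf, hpdf, ← hsq,
      show -((1 + t ^ 2) / 2) * x ^ 2 = -x ^ 2 / 2 + -(x * t) ^ 2 / 2 by ring, Real.exp_add]
    ring
  have hne : ∀ᵐ x : ℝ, x ≠ 0 := by simp [ae_iff]
  rw [integral_congr_ae (hne.mono hinner)]
  have hker : Integrable (fun q : ℝ × ℝ => |q.2| * Real.exp (-((1 + q.1 ^ 2) / 2) * q.2 ^ 2))
      (volume.prod volume) := by
    rw [integrable_prod_iff (by fun_prop)]
    refine ⟨Filter.Eventually.of_forall fun t =>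
      integrable_abs_mul_exp_neg_mul_sq (b := (1 + t ^ 2) / 2) (by positivity), ?_⟩
    have : ∀ t : ℝ, ∫ x : ℝ, ‖|x| * Real.exp (-((1 + t ^ 2) / 2) * x ^ 2)‖ =
        2 * (1 + t ^ 2)⁻¹ := by
      intro t
      simp only [norm_mul, Real.norm_eq_abs, abs_abs, Real.abs_exp]
      rw [integral_abs_mul_exp_neg_mul_sq (by positivity)]
      field_simp
    simp_rw [this]
    exact integrable_inv_one_add_sq.const_mul 2
  have hInt : Integrable (fun q : ℝ × ℝ => unimodularSign (ρ + σ * q.2) *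
        (1 / (2 * Real.pi) * (|q.1| * Real.exp (-((1 + q.2 ^ 2) / 2) * q.1 ^ 2))))
      (volume.prod volume) := by
    refine (hker.swap.const_mul (1 / (2 * Real.pi))).bdd_mul (c := 1) ?_ ?_
    · exact (measurable_unimodularSign.comp (by fun_prop)).aestronglyMeasurable
    · exact Filter.Eventually.of_forall fun t => norm_unimodularSign_le _
  rw [integral_integral_swap hInt]
  have hin : ∀ t : ℝ, ∫ x : ℝ, unimodularSign (ρ + σ * t) *
      (1 / (2 * Real.pi) * (|x| * Real.exp (-((1 + t ^ 2) / 2) * x ^ 2))) =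
      1 / Real.pi * (unimodularSign (ρ + σ * t) * (1 + t ^ 2)⁻¹) := by
    intro t
    rw [integral_const_mul, integral_const_mul, integral_abs_mul_exp_neg_mul_sq (by positivity)]
    field_simp
  simp_rw [hin]
  rw [integral_const_mul, integral_unimodularSign_add_mul_div hσ, Real.arcsin_eq_arctan,
    show √(1 - ρ ^ 2) = σ by rw [← h, add_sub_cancel_left, Real.sqrt_sq hσ.le]]
  · ring
  · constructor <;> nlinarith

/-- Grothendieck's identity: the entrywise `(2/π) arcsin` of a real correlation matrix is an
average of sign matrices. -/
theorem arcsin_mem_roundedMatrices {k : ℕ} (hk : 1 ≤ k) {S : Matrix (Fin k) (Fin k) ℝ}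
    (hS : S ∈ correlationMatrices ℝ k) :
    (Matrix.of fun i j => 2 / Real.pi * Real.arcsin (S i j)) ∈ roundedMatrices ℝ k := by
  obtain ⟨v, hv⟩ := exists_gram_eq hS.1
  have hvn : ∀ i, ⟪v i, v i⟫ = 1 := fun i => by rw [hv, hS.2]
  have hvn' : ∀ i, ‖v i‖ ^ 2 = 1 := fun i => by rw [← real_inner_self_eq_norm_sq, hvn]
  let μ := stdGaussian (EuclideanSpace ℝ (Fin k))
  have hpair : ∀ i j (σ : ℝ), S i j ^ 2 + σ ^ 2 = 1 →
      μ.map (fun x => (⟪v i, x⟫, ⟪v j, x⟫)) =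
      ((gaussianReal 0 1).prod (gaussianReal 0 1)).map (fun w => (w.1, S i j * w.1 + σ * w.2)) := by
    intro i j σ hσ
    have := map_prodMk_stdGaussian (innerSL ℝ (v i)) (innerSL ℝ (v j))
      (S i j • ContinuousLinearMap.id ℝ ℝ) σ (fun t => t • v i) (fun t => t • v j)
      (fun t => S i j * t) ?_ ?_ ?_ ?_
    · rw [stdGaussian_real] at this
      simpa [innerSL_apply_apply] using this
    · intro t x
      simp [real_inner_smul_left, mul_comm]
    · intro t x
      simp [real_inner_smul_left, mul_comm]
    · intro t x
      simp
      ring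
    · intro s t
      rw [norm_add_sq_real, real_inner_smul_left, real_inner_smul_right, hv, norm_smul, norm_smul,
        mul_pow, mul_pow, hvn', hvn']
      simp only [Real.norm_eq_abs, sq_abs]
      linear_combination -t ^ 2 * hσ
  have hsd : ∀ i j, S i j ^ 2 ≤ 1 := by
    intro i j
    have := real_inner_mul_inner_self_le (v i) (v j)
    rw [hvn, hvn, hv] at this
    nlinarith
  have hmeas : ∀ i, Measurable fun x : EuclideanSpace ℝ (Fin k) => unimodularSign ⟪v i, x⟫ :=
    fun i => measurable_unimodularSign.comp (by fun_prop)
  have hone : ∀ i, ∀ᵐ x ∂μ, ⟪v i, x⟫ ≠ 0 := by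
    intro i
    have h0 : ∀ᵐ w ∂((gaussianReal 0 1).prod (gaussianReal 0 1)), w.1 ≠ 0 := by
      refine (Measure.quasiMeasurePreserving_fst (μ := gaussianReal 0 1)
        (ν := gaussianReal 0 1)).ae (p := fun x => x ≠ 0) ?_
      exact ae_ne_zero_gaussianReal
    -- The pair law with equal indices and σ = 0 also yields the one-dimensional marginal.
    have h1 := hpair i i 0 (by simp [hS.2])
    refine ae_of_ae_map (f := fun x => (⟪v i, x⟫, ⟪v i, x⟫)) (p := fun w : ℝ × ℝ => w.1 ≠ 0)
      (by fun_prop) ?_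
    rw [h1]
    exact (ae_map_iff (p := fun w : ℝ × ℝ => w.1 ≠ 0) (by fun_prop)
      (measurable_fst (measurableSet_singleton 0)).compl).2 h0
  have hmem := of_integral_mem_roundedMatrices hk μ (p := fun x i => unimodularSign ⟪v i, x⟫)
    (fun i => (hone i).mono fun x hx => norm_unimodularSign hx) hmeas
  convert hmem using 1
  ext i j
  simp only [of_apply, star_trivial]
  have hσ := Real.sq_sqrt (sub_nonneg.2 (hsd i j))
  have hσ1 : S i j ^ 2 + √(1 - S i j ^ 2) ^ 2 = 1 := by rw [hσ]; ring
  have hm2 : Measurable fun w : ℝ × ℝ => unimodularSign w.1 * unimodularSign w.2 :=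
    (measurable_unimodularSign.comp measurable_fst).mul
      (measurable_unimodularSign.comp measurable_snd)
  have h2 : ∫ x, unimodularSign ⟪v i, x⟫ * unimodularSign ⟪v j, x⟫ ∂μ =
      ∫ w : ℝ × ℝ, unimodularSign w.1 * unimodularSign w.2
        ∂(μ.map (fun x => (⟪v i, x⟫, ⟪v j, x⟫))) := by
    rw [integral_map (by fun_prop) hm2.aestronglyMeasurable]
  rw [← integral_integral_unimodularSign (Real.sqrt_nonneg _) hσ1, h2, hpair i j _ hσ1,
    integral_map (by fun_prop) hm2.aestronglyMeasurable, integral_prod]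
  refine Integrable.of_bound (C := 1) ?_ (Filter.Eventually.of_forall fun w => ?_)
  · exact (hm2.comp (by fun_prop)).aestronglyMeasurable
  · rw [norm_mul]
    exact mul_le_one₀ (norm_unimodularSign_le _) (norm_nonneg _) (norm_unimodularSign_le _)

end RealSign

end Grothendieck

namespace Grothendieck

open Matrix

/-! ### The real upper bound sinh(π/2). -/

section RealBound

theorem pow_mem_roundedMatrices {𝕜 : Type} [RCLike 𝕜] {k : ℕ} (hk : 1 ≤ k)
    {X : Matrix (Fin k) (Fin k) 𝕜} (hX : X ∈ roundedMatrices 𝕜 k) (n : ℕ) :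
    (Matrix.of fun i j => X i j ^ n) ∈ roundedMatrices 𝕜 k := by
  induction n with
  | zero => simpa using one_mem_roundedMatrices hk
  | succ n ih =>
    have := hadamard_mem_roundedMatrices hk ih hX
    convert this using 1
    ext i j
    simp [pow_succ]

theorem sum_mul_hasSum {k : ℕ} {B S : Matrix (Fin k) (Fin k) ℝ} {f : ℕ → ℝ}
    {X : ℕ → Matrix (Fin k) (Fin k) ℝ}
    (h : ∀ i j, HasSum (fun n => f n * X n i j) (S i j)) :
    HasSum (fun n => f n * (Bᴴ * X n).trace) (Bᴴ * S).trace := by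
  simp_rw [trace_conjTranspose_mul, Finset.mul_sum]
  refine hasSum_sum fun i _ => hasSum_sum fun j _ => ?_
  refine ((h i j).mul_left (star (B i j))).congr_fun ?_
  intro n
  ring

/-- S = sin(πA/2) entrywise with A in R. Every entrywise power of A lies in R, so the sine series is
bounded by the series of its absolute coefficients, which sums to sinh(π/2). -/
theorem isCorrelationBound_real : IsCorrelationBound ℝ (Real.sinh (Real.pi / 2)) := by
  rw [isCorrelationBound_iff]
  intro k hk B M hM S hS
  have hA := arcsin_mem_roundedMatrices hk hS
  set A : Matrix (Fin k) (Fin k) ℝ := Matrix.of fun i j => 2 / Real.pi * Real.arcsin (S i j) with hAd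
  have habs : ∀ i j, -1 ≤ S i j ∧ S i j ≤ 1 := by
    intro i j
    obtain ⟨v, hv⟩ := exists_gram_eq hS.1
    have := abs_real_inner_le_norm (v i) (v j)
    have hn : ∀ i, ‖v i‖ = 1 := fun i => by
      have := real_inner_self_eq_norm_sq (v i)
      rw [hv, hS.2] at this
      exact (pow_eq_one_iff_of_nonneg (norm_nonneg _) two_ne_zero).1 this.symm
    rw [hn, hn, hv, one_mul] at this
    exact abs_le.1 this
  have hsin : ∀ i j, Real.sin (Real.pi / 2 * A i j) = S i j := by
    intro i j
    have : Real.pi / 2 * A i j = Real.arcsin (S i j) := by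
      simp only [hAd, of_apply]
      field_simp
    rw [this, Real.sin_arcsin (habs i j).1 (habs i j).2]
  set c : ℕ → ℝ := fun n => (Real.pi / 2) ^ (2 * n + 1) / (2 * n + 1).factorial with hc
  set X : ℕ → Matrix (Fin k) (Fin k) ℝ := fun n => Matrix.of fun i j => A i j ^ (2 * n + 1)
  have hsum : HasSum (fun n => ((-1) ^ n * c n) * (Bᴴ * X n).trace) (Bᴴ * S).trace := by
    refine sum_mul_hasSum fun i j => ?_
    rw [← hsin i j]
    refine (Real.hasSum_sin (Real.pi / 2 * A i j)).congr_fun fun n => ?_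
    simp only [hc, X, of_apply, mul_pow]
    ring
  have hsinh : HasSum (fun n => c n * M) (Real.sinh (Real.pi / 2) * M) :=
    (Real.hasSum_sinh (Real.pi / 2)).mul_right M
  refine le_of_eq_of_le (congrArg norm hsum.tsum_eq.symm) ?_
  refine tsum_of_norm_bounded hsinh fun n => ?_
  have hc0 : 0 ≤ c n := by positivity
  rw [norm_mul, norm_mul, norm_pow, norm_neg, norm_one, one_pow, one_mul, Real.norm_of_nonneg hc0]
  exact mul_le_mul_of_nonneg_left
    (norm_trace_le_of_mem_roundedMatrices hM (pow_mem_roundedMatrices hk hA _)) hc0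

end RealBound

/-! ### Strictness in the real case. -/

section RealLowerBound

theorem not_isCorrelationBound_one_real : ¬ IsCorrelationBound ℝ 1 := by
  intro h
  rw [isCorrelationBound_iff] at h
  -- S comes from three plane vectors at angles of 120°. The diagonal 2/3 balances the values -4 and
  -- 4 taken on sign vectors, while S gives 5.
  let B : Matrix (Fin 3) (Fin 3) ℝ := !![2/3, -1, -1; -1, 2/3, -1; -1, -1, 2/3]
  let V : Matrix (Fin 2) (Fin 3) ℝ := !![1, -1/2, -1/2; 0, √3/2, -(√3/2)]
  let S : Matrix (Fin 3) (Fin 3) ℝ := !![1, -1/2, -1/2; -1/2, 1, -1/2; -1/2, -1/2, 1]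
  have h3 : √3 * √3 = 3 := Real.mul_self_sqrt (by norm_num)
  have hVS : S = Vᴴ * V := by
    ext i j
    fin_cases i <;> fin_cases j <;> simp [S, V, mul_apply, Fin.sum_univ_succ] <;>
      linarith
  have hS : S ∈ correlationMatrices ℝ 3 := by
    refine ⟨hVS ▸ posSemidef_conjTranspose_mul_self V, fun i => ?_⟩
    fin_cases i <;> simp [S]
  obtain ⟨M, hM⟩ := exists_isGreatest_rankOneValues (by norm_num) B
  have h1 := h 3 (by norm_num) B M hM S hS
  have hM4 : M ≤ 4 := by
    obtain ⟨T, hT, rfl⟩ := hM.1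
    obtain ⟨p, hp, rfl⟩ := (mem_rankOneCorrelationMatrices_iff (by norm_num)).1 hT
    rw [trace_conjTranspose_mul]
    have hp' : ∀ i, p i = 1 ∨ p i = -1 := fun i => by
      have := hp i
      rw [Real.norm_eq_abs] at this
      exact eq_or_eq_neg_of_abs_eq this
    simp only [Fin.sum_univ_succ, vecMulVec_apply, B]
    rcases hp' 0 with h0 | h0 <;> rcases hp' 1 with h1 | h1 <;> rcases hp' 2 with h2 | h2 <;>
      simp [h0, h1, h2] <;> norm_num [abs_le]
  have htr : (Bᴴ * S).trace = 5 := by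
    rw [trace_conjTranspose_mul]
    simp [Fin.sum_univ_succ, B, S]
    norm_num
  rw [htr] at h1
  norm_num at h1
  linarith

end RealLowerBound

end Grothendieck

namespace Grothendieck

/-! ### Kaluza's argument for logarithmic derivatives. -/

section LogDeriv

/-- The coefficients of `x f' / f` for the power series `f` with coefficients `g`, `g 0 = 1`. -/
noncomputable def logDerivCoeff (g : ℕ → ℝ) : ℕ → ℝ
  | n => n * g n - ∑ k : Fin n, logDerivCoeff g k * g (n - k)

theorem sum_logDerivCoeff_mul {g : ℕ → ℝ} (h0 : g 0 = 1) (n : ℕ) :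
    ∑ k ∈ Finset.range (n + 1), logDerivCoeff g k * g (n - k) = n * g n := by
  rw [Finset.sum_range_succ, Nat.sub_self, h0, mul_one]
  have h : logDerivCoeff g n = n * g n - ∑ k : Fin n, logDerivCoeff g k * g (n - k) := by
    rw [logDerivCoeff]
  rw [h, Finset.sum_range]
  ring

theorem logDerivCoeff_zero (g : ℕ → ℝ) : logDerivCoeff g 0 = 0 := by
  rw [logDerivCoeff]
  simp

/-- Kaluza's argument: a lower bound for the logarithmic derivative of a series with increasing
coefficient ratios. -/
theorem le_logDerivCoeff {g τ a : ℕ → ℝ} (h0 : g 0 = 1) (hg : ∀ n, 0 ≤ g n)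
    (hτ : ∀ n, g (n + 1) = τ n * g n) (hmono : Monotone τ) (ha : a 0 = 0)
    {R : ℕ → ℝ} (hR : ∀ n, R n = n * g n - ∑ k ∈ Finset.range (n + 1), a k * g (n - k))
    (hR1 : 0 ≤ R 1) (hRs : ∀ n, τ n * R (n + 1) ≤ R (n + 2)) (n : ℕ) :
    a n ≤ logDerivCoeff g n := by
  set ε : ℕ → ℝ := fun k => logDerivCoeff g k - a k with hε
  have hsum : ∀ n, ∑ k ∈ Finset.range (n + 1), ε k * g (n - k) = R n := by
    intro n
    simp only [hε, sub_mul, Finset.sum_sub_distrib, sum_logDerivCoeff_mul h0, hR]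
  have hε0 : ε 0 = 0 := by simp [hε, ha, logDerivCoeff_zero]
  suffices 0 ≤ ε n by simpa [hε] using this
  induction n using Nat.strong_induction_on with
  | _ n ih =>
    match n with
    | 0 => exact hε0.ge
    | 1 =>
      have := hsum 1
      rw [Finset.sum_range_succ, Finset.sum_range_one, hε0, zero_mul, zero_add, Nat.sub_self, h0,
        mul_one] at this
      rw [this]
      exact hR1
    | n + 2 =>
      have h2 := hsum (n + 2)
      rw [Finset.sum_range_succ, Nat.sub_self, h0, mul_one] at h2
      have h1 := hsum (n + 1)
      -- Since `ε 0 = 0`, only k ≥ 1 matters, where `τ (n + 1 - k) ≤ τ n` and `ε k ≥ 0` by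
      -- induction. What remains is `ε (n + 2) ≥ R (n + 2) - τ n * R (n + 1)`.
      have hle : ∑ k ∈ Finset.range (n + 2), ε k * g (n + 2 - k) ≤
          τ n * ∑ k ∈ Finset.range (n + 2), ε k * g (n + 1 - k) := by
        rw [Finset.mul_sum]
        refine Finset.sum_le_sum fun k hk => ?_
        rw [Finset.mem_range] at hk
        rcases Nat.eq_zero_or_pos k with rfl | hkpos
        · rw [hε0]
          simp
        · rw [show n + 2 - k = (n + 1 - k) + 1 by omega, hτ]
          have h3 : τ (n + 1 - k) ≤ τ n := hmono (by omega)
          have h4 := mul_nonneg (ih k hk) (hg (n + 1 - k))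
          nlinarith
      rw [h1] at hle
      linarith [hRs n]

end LogDeriv

/-! ### Lower bound for the logarithmic derivative of 8(G - 1)/x. -/

section SignCoeff

noncomputable def coeffRatio (n : ℕ) : ℝ := (2 * n + 1) ^ 2 / (4 * (n + 1) * (n + 2))

/-- The coefficients of `₂F₁(1/2, 1/2; 2; x)`. -/
noncomputable def signCoeff : ℕ → ℝ
  | 0 => 1
  | n + 1 => coeffRatio n * signCoeff n

/-- Coefficients of 8(G - 1)/x; the factor 8 normalises the constant term to 1. -/
noncomputable def tailCoeff (n : ℕ) : ℝ := 8 * signCoeff (n + 1)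

theorem coeffRatio_pos (n : ℕ) : 0 < coeffRatio n := by
  unfold coeffRatio
  positivity

theorem coeffRatio_monotone : Monotone coeffRatio := by
  refine monotone_nat_of_le_succ fun n => ?_
  unfold coeffRatio
  rw [div_le_div_iff₀ (by positivity) (by positivity)]
  push_cast
  have : (0 : ℝ) ≤ n := Nat.cast_nonneg n
  nlinarith [mul_nonneg this this, mul_nonneg (mul_nonneg this this) this]

theorem signCoeff_pos (n : ℕ) : 0 < signCoeff n := by
  induction n with
  | zero => simp [signCoeff]
  | succ n ih => exact mul_pos (coeffRatio_pos n) ih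

theorem tailCoeff_pos (n : ℕ) : 0 < tailCoeff n := mul_pos (by norm_num) (signCoeff_pos _)

theorem tailCoeff_zero : tailCoeff 0 = 1 := by
  simp [tailCoeff, signCoeff, coeffRatio]
  norm_num

theorem tailCoeff_succ (n : ℕ) : tailCoeff (n + 1) = coeffRatio (n + 1) * tailCoeff n := by
  simp only [tailCoeff, signCoeff]
  ring

theorem logDerivCoeff_signCoeff_nonneg (n : ℕ) : 0 ≤ logDerivCoeff signCoeff n := by
  refine le_logDerivCoeff (g := signCoeff) (τ := coeffRatio) (a := fun _ => 0)
    (R := fun n => n * signCoeff n) rfl (fun n => (signCoeff_pos n).le) (fun n => rfl)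
    coeffRatio_monotone rfl (fun n => by simp) ?_ (fun n => ?_) n
  · simpa using (signCoeff_pos 1).le
  · have h1 : signCoeff (n + 2) = coeffRatio (n + 1) * signCoeff (n + 1) := rfl
    rw [h1]
    have h2 : coeffRatio n ≤ coeffRatio (n + 1) := coeffRatio_monotone (Nat.le_succ n)
    have h3 := signCoeff_pos (n + 1)
    have h4 := coeffRatio_pos n
    push_cast
    have h5 : coeffRatio n * signCoeff (n + 1) ≤ coeffRatio (n + 1) * signCoeff (n + 1) :=
      mul_le_mul_of_nonneg_right h2 h3.le
    have h6 : (0 : ℝ) ≤ n := Nat.cast_nonneg n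
    have h7 := mul_pos h4 h3
    nlinarith

/-- The convolution of `tailCoeff` with `1 / (k + 1)`. -/
noncomputable def harmonicConv (n : ℕ) : ℝ :=
  ∑ j ∈ Finset.range (n + 1), tailCoeff j / ((n : ℝ) - j + 1)

theorem four_mul_tailCoeff_succ (j : ℕ) :
    4 * ((j : ℝ) + 2) * (j + 3) * tailCoeff (j + 1) = (2 * j + 3) ^ 2 * tailCoeff j := by
  rw [tailCoeff_succ, coeffRatio]
  push_cast
  field_simp
  ring

/-- With d the denominator of a summand, n + 3 = (j + 1) + d and n + 4 = (j + 2) + d on the left,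
and 2n + 5 = (2j + 3) + 2d on the right. The parts still divided by d match after a shift of j by
the recurrence of `tailCoeff`, except for j = 0, which gives 8 / (n + 2); the others are plain sums.
-/
theorem harmonicConv_succ (n : ℕ) :
    4 * ((n : ℝ) + 3) * (n + 4) * harmonicConv (n + 1) = (2 * n + 5) ^ 2 * harmonicConv n +
      8 / (n + 2) + (8 * n + 20) * tailCoeff (n + 1) +
      4 * ∑ j ∈ Finset.range (n + 2), tailCoeff j := by
  have h1 : 4 * ((n : ℝ) + 3) * (n + 4) * harmonicConv (n + 1) =
      ∑ j ∈ Finset.range (n + 2), (4 * ((j : ℝ) + 1) * (j + 2) * tailCoeff j / (n + 2 - j)) +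
      ∑ j ∈ Finset.range (n + 2), (4 * (2 * (j : ℝ) + 3) + 4 * (n + 2 - j)) * tailCoeff j := by
    rw [harmonicConv, Finset.mul_sum, ← Finset.sum_add_distrib]
    refine Finset.sum_congr rfl fun j hj => ?_
    have hj' : (j : ℝ) + 1 ≤ n + 2 := by
      rw [Finset.mem_range] at hj
      exact_mod_cast hj
    have hne : (n : ℝ) + 2 - j ≠ 0 := by linarith
    push_cast
    rw [show (n : ℝ) + 1 - j + 1 = n + 2 - j by ring]
    field_simp
    ring
  have h2 : (2 * (n : ℝ) + 5) ^ 2 * harmonicConv n =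
      ∑ j ∈ Finset.range (n + 1), ((2 * (j : ℝ) + 3) ^ 2 * tailCoeff j / (n + 1 - j)) +
      ∑ j ∈ Finset.range (n + 1), (4 * (2 * (j : ℝ) + 3) + 4 * (n + 1 - j)) * tailCoeff j := by
    rw [harmonicConv, Finset.mul_sum, ← Finset.sum_add_distrib]
    refine Finset.sum_congr rfl fun j hj => ?_
    have hj' : (j : ℝ) + 1 ≤ n + 1 := by
      rw [Finset.mem_range] at hj
      exact_mod_cast hj
    have hne : (n : ℝ) + 1 - j ≠ 0 := by linarith
    rw [show (n : ℝ) - j + 1 = n + 1 - j by ring]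
    field_simp
    ring
  rw [h1, h2, Finset.sum_range_succ' _ (n + 1)]
  have h3 : ∀ j : ℕ, 4 * (((j + 1 : ℕ) : ℝ) + 1) * (((j + 1 : ℕ) : ℝ) + 2) * tailCoeff (j + 1) /
      ((n : ℝ) + 2 - ((j + 1 : ℕ) : ℝ)) = (2 * (j : ℝ) + 3) ^ 2 * tailCoeff j / (n + 1 - j) := by
    intro j
    rw [← four_mul_tailCoeff_succ]
    push_cast
    congr 1 <;> ring
  simp_rw [h3]
  rw [Finset.sum_range_succ _ (n + 1), Finset.sum_range_succ tailCoeff (n + 1)]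
  have h4 : ∑ j ∈ Finset.range (n + 1), (4 * (2 * (j : ℝ) + 3) + 4 * (n + 2 - j)) * tailCoeff j =
      ∑ j ∈ Finset.range (n + 1), (4 * (2 * (j : ℝ) + 3) + 4 * (n + 1 - j)) * tailCoeff j +
      4 * ∑ j ∈ Finset.range (n + 1), tailCoeff j := by
    rw [Finset.mul_sum, ← Finset.sum_add_distrib]
    refine Finset.sum_congr rfl fun j _ => ?_
    ring
  rw [h4]
  push_cast
  rw [tailCoeff_zero]
  ring

/-- The difference between `n * tailCoeff n` and the convolution with `3 / (4 (k + 1))`, `k ≥ 1`. -/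
noncomputable def kaluzaRemainder (n : ℕ) : ℝ :=
  (n + 3 / 4) * tailCoeff n - 3 / 4 * harmonicConv n

/-- This is exactly the inequality to which `coeffRatio_mul_kaluzaRemainder_le` reduces; the
rational factor on the right is read off from there. Equality holds at m = 0. -/
theorem sum_tailCoeff_le (m : ℕ) :
    ∑ j ∈ Finset.range (m + 2), tailCoeff j + 2 / ((m : ℝ) + 2) ≤
      (16 * ((m : ℝ) + 1) ^ 4 + 40 * (m + 1) ^ 3 + 40 * (m + 1) ^ 2 + 48 * (m + 1) + 27) /
        (3 * (2 * m + 3) ^ 2) * tailCoeff (m + 1) := by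
  have t1 : tailCoeff 1 = 3 / 8 := by
    rw [tailCoeff_succ, tailCoeff_zero, coeffRatio]
    norm_num
  induction m with
  | zero =>
    rw [Finset.sum_range_succ, Finset.sum_range_one, tailCoeff_zero, t1]
    norm_num
  | succ m ih =>
    -- The induction step discards the decrease of 2 / (m + 2). The resulting polynomial is positive
    -- only from the next index on, so the case 1 is checked by hand.
    match m with
    | 0 =>
      have t2 : tailCoeff 2 = 25 / 128 := by
        rw [tailCoeff_succ, t1, coeffRatio]
        norm_num
      rw [Finset.sum_range_succ, Finset.sum_range_succ, Finset.sum_range_one, tailCoeff_zero]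
      norm_num [t1, t2]
    | m + 1 =>
      rw [Finset.sum_range_succ]
      have hg := tailCoeff_pos (m + 2)
      rw [show m + 1 + 1 + 1 = (m + 2) + 1 by ring, tailCoeff_succ (m + 2), coeffRatio]
      push_cast at ih ⊢
      have hm : (0 : ℝ) ≤ m := Nat.cast_nonneg m
      have hstep : (2 : ℝ) / (m + 1 + 1 + 2) ≤ 2 / (m + 1 + 2) := by
        gcongr
        linarith
      have hpoly : 0 ≤ (16 * ((m : ℝ) + 1 + 1 + 1) ^ 4 + 40 * (m + 1 + 1 + 1) ^ 3 +
            40 * (m + 1 + 1 + 1) ^ 2 + 48 * (m + 1 + 1 + 1) + 27) /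
            (3 * (2 * (m + 1 + 1) + 3) ^ 2) *
            ((2 * (m + 2 + 1) + 1) ^ 2 / (4 * (m + 2 + 1 + 1) * (m + 2 + 1 + 2))) -
          (16 * ((m : ℝ) + 1 + 1) ^ 4 + 40 * (m + 1 + 1) ^ 3 + 40 * (m + 1 + 1) ^ 2 +
            48 * (m + 1 + 1) + 27) / (3 * (2 * (m + 1) + 3) ^ 2) -
          ((2 * (m + 2 + 1) + 1) ^ 2 / (4 * (m + 2 + 1 + 1) * (m + 2 + 1 + 2))) := by
        have : (16 * ((m : ℝ) + 1 + 1 + 1) ^ 4 + 40 * (m + 1 + 1 + 1) ^ 3 +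
            40 * (m + 1 + 1 + 1) ^ 2 + 48 * (m + 1 + 1 + 1) + 27) /
            (3 * (2 * (m + 1 + 1) + 3) ^ 2) *
            ((2 * (m + 2 + 1) + 1) ^ 2 / (4 * (m + 2 + 1 + 1) * (m + 2 + 1 + 2))) -
          (16 * ((m : ℝ) + 1 + 1) ^ 4 + 40 * (m + 1 + 1) ^ 3 + 40 * (m + 1 + 1) ^ 2 +
            48 * (m + 1 + 1) + 27) / (3 * (2 * (m + 1) + 3) ^ 2) -
          ((2 * (m + 2 + 1) + 1) ^ 2 / (4 * (m + 2 + 1 + 1) * (m + 2 + 1 + 2))) =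
          (280 + 3576 * m + 2824 * m ^ 2 + 744 * m ^ 3 + 64 * m ^ 4) /
            (12 * (2 * (m + 2) + 1) ^ 2 * (m + 4) * (m + 5)) := by
          have e1 : (2 * ((m : ℝ) + 1 + 1) + 3) = 2 * (m + 2 + 1) + 1 := by ring
          rw [e1]
          field_simp
          ring
        rw [this]
        positivity
      have := mul_nonneg hpoly hg.le
      linarith

/-- After multiplication by 4(m + 3)(m + 4), the recurrence for `harmonicConv` cancels all
convolution terms and leaves three times the gap in `sum_tailCoeff_le`. -/
theorem coeffRatio_mul_kaluzaRemainder_le (m : ℕ) :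
    coeffRatio (m + 2) * kaluzaRemainder m ≤ kaluzaRemainder (m + 1) := by
  have hU := harmonicConv_succ m
  have hs := sum_tailCoeff_le m
  have hr : coeffRatio (m + 2) * (4 * ((m : ℝ) + 3) * (m + 4)) = (2 * m + 5) ^ 2 := by
    rw [coeffRatio]
    push_cast
    field_simp
    ring
  have hg := four_mul_tailCoeff_succ m
  have hm : (0 : ℝ) ≤ m := Nat.cast_nonneg m
  have hpos : 0 < 4 * ((m : ℝ) + 3) * (m + 4) := by positivity
  rw [← sub_nonneg]
  refine (mul_nonneg_iff_of_pos_left hpos).1 ?_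
  have hgm : tailCoeff m = 4 * ((m : ℝ) + 2) * (m + 3) * tailCoeff (m + 1) / (2 * m + 3) ^ 2 := by
    rw [hg]
    field_simp
  have key : 4 * ((m : ℝ) + 3) * (m + 4) *
      (kaluzaRemainder (m + 1) - coeffRatio (m + 2) * kaluzaRemainder m) =
      3 * ((16 * ((m : ℝ) + 1) ^ 4 + 40 * (m + 1) ^ 3 + 40 * (m + 1) ^ 2 + 48 * (m + 1) + 27) /
        (3 * (2 * m + 3) ^ 2) * tailCoeff (m + 1) -
        (∑ j ∈ Finset.range (m + 2), tailCoeff j + 2 / ((m : ℝ) + 2))) := by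
    unfold kaluzaRemainder
    push_cast
    have e : 4 * ((m : ℝ) + 3) * (m + 4) * ((m + 1 + 3 / 4) * tailCoeff (m + 1) -
        3 / 4 * harmonicConv (m + 1) - coeffRatio (m + 2) * ((m + 3 / 4) * tailCoeff m -
        3 / 4 * harmonicConv m)) =
        4 * ((m : ℝ) + 3) * (m + 4) * ((m + 1 + 3 / 4) * tailCoeff (m + 1)) -
        3 / 4 * (4 * ((m : ℝ) + 3) * (m + 4) * harmonicConv (m + 1)) -
        (coeffRatio (m + 2) * (4 * ((m : ℝ) + 3) * (m + 4))) * ((m + 3 / 4) * tailCoeff m -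
        3 / 4 * harmonicConv m) := by ring
    rw [e, hU, hr, hgm]
    field_simp
    ring
  rw [key]
  linarith

theorem kaluzaRemainder_nonneg (m : ℕ) : 0 ≤ kaluzaRemainder m := by
  induction m with
  | zero => simp [kaluzaRemainder, harmonicConv, tailCoeff_zero]
  | succ m ih =>
    exact (mul_nonneg (coeffRatio_pos _).le ih).trans (coeffRatio_mul_kaluzaRemainder_le m)

/-- Kaluza's argument with comparison coefficients 3 / (4(k + 1)) for k ≥ 1. The constant 3/4 cannot
be improved: at n = 1 both sides are 3/8. -/
theorem le_logDerivCoeff_tailCoeff (n : ℕ) (hn : 1 ≤ n) :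
    3 / (4 * ((n : ℝ) + 1)) ≤ logDerivCoeff tailCoeff n := by
  have h := le_logDerivCoeff (g := tailCoeff) (τ := fun n => coeffRatio (n + 1))
    (a := fun k => if k = 0 then 0 else 3 / (4 * ((k : ℝ) + 1))) (R := kaluzaRemainder)
    tailCoeff_zero (fun n => (tailCoeff_pos n).le) tailCoeff_succ
    (fun a b hab => coeffRatio_monotone (by omega)) (by simp) ?_ (kaluzaRemainder_nonneg 1)
    (fun n => ?_) n
  · rwa [if_neg (by omega)] at h
  · intro m
    rw [Finset.sum_range_succ', kaluzaRemainder, harmonicConv, ← Finset.sum_range_reflect,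
      Finset.sum_range_succ']
    simp only [Nat.add_eq_zero_iff, one_ne_zero, and_false, if_false, if_true]
    have e : ∀ k ∈ Finset.range m, tailCoeff (m + 1 - 1 - (k + 1)) /
        ((m : ℝ) - ((m + 1 - 1 - (k + 1) : ℕ) : ℝ) + 1) =
        tailCoeff (m - (k + 1)) / ((k : ℝ) + 2) := by
      intro k hk
      rw [Finset.mem_range] at hk
      rw [show m + 1 - 1 - (k + 1) = m - (k + 1) by omega, Nat.cast_sub (by omega)]
      push_cast
      congr 1
      ring
    rw [Finset.sum_congr rfl e]
    have e2 : ∑ k ∈ Finset.range m, 3 / (4 * (((k + 1 : ℕ) : ℝ) + 1)) * tailCoeff (m - (k + 1)) =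
        3 / 4 * ∑ k ∈ Finset.range m, tailCoeff (m - (k + 1)) / ((k : ℝ) + 2) := by
      rw [Finset.mul_sum]
      refine Finset.sum_congr rfl fun k _ => ?_
      push_cast
      rw [show (k : ℝ) + 1 + 1 = k + 2 by ring]
      field_simp
    rw [e2]
    simp
    ring
  -- The remainder inequality carries the ratio of index n + 3, which dominates the needed one of
  -- index n + 1 because the remainder is nonnegative.
  · refine le_trans ?_ (coeffRatio_mul_kaluzaRemainder_le (n + 1))
    exact mul_le_mul_of_nonneg_right (coeffRatio_monotone (by omega)) (kaluzaRemainder_nonneg _)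

end SignCoeff

end Grothendieck

namespace Grothendieck

/-! ### Upper bound for the logarithmic derivative of G. -/

section Riccati

open PowerSeries in
-- With θ = x d/dx and r = θG / G, the hypergeometric equation 4(θ² + θ)G (1 - x) = xG becomes the
-- Riccati equation 4(θr + r² + r)(1 - x) = x. Coefficientwise, (n + 1) rₙ + (r²)ₙ = 1/4 for n ≥ 1,
-- and (r²)ₙ ≥ 0 since r has nonnegative coefficients.
theorem add_one_mul_logDerivCoeff_signCoeff_le (n : ℕ) :
    ((n : ℝ) + 1) * logDerivCoeff signCoeff n ≤ 1 / 4 := by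
  set G : PowerSeries ℝ := PowerSeries.mk signCoeff with hG
  set r : PowerSeries ℝ := PowerSeries.mk (logDerivCoeff signCoeff) with hr
  have hθ : ∀ f : PowerSeries ℝ, ∀ n : ℕ, coeff n (X * d⁄dX ℝ f) = n * coeff n f := by
    intro f n
    cases n with
    | zero => simp
    | succ n =>
      rw [coeff_succ_X_mul, coeff_derivative]
      push_cast
      ring
  have h4 : ∀ (f : PowerSeries ℝ) (n : ℕ), coeff n (4 * f) = 4 * coeff n f := by
    intro f n
    rw [show (4 : PowerSeries ℝ) = C (4 : ℝ) from (map_ofNat C 4).symm, coeff_C_mul]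
  have hrG : X * d⁄dX ℝ G = r * G := by
    ext n
    rw [hθ, coeff_mul, Finset.Nat.sum_antidiagonal_eq_sum_range_succ_mk]
    simp only [hr, hG, coeff_mk]
    exact (sum_logDerivCoeff_mul rfl n).symm
  have hode : 4 * (X * d⁄dX ℝ (X * d⁄dX ℝ G) + X * d⁄dX ℝ G) * (1 - X) = X * G := by
    ext n
    rw [mul_sub, mul_one, map_sub]
    cases n with
    | zero => simp
    | succ n =>
      rw [coeff_succ_mul_X, coeff_succ_X_mul, h4, h4, map_add, map_add, hθ, hθ, hθ, hθ]
      simp only [hG, coeff_mk, signCoeff, coeffRatio]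
      push_cast
      field_simp
      ring
  have hG0 : G ≠ 0 := by
    intro h
    have := congrArg (coeff 0) h
    simp [hG, signCoeff] at this
  have hric : 4 * (X * d⁄dX ℝ r + r * r + r) * (1 - X) = X := by
    have h2 : X * d⁄dX ℝ (X * d⁄dX ℝ G) = (X * d⁄dX ℝ r + r * r) * G := by
      rw [hrG, Derivation.leibniz]
      simp only [smul_eq_mul]
      linear_combination r * hrG
    rw [h2, hrG] at hode
    refine mul_right_cancel₀ hG0 ?_
    linear_combination hode
  set s : PowerSeries ℝ := X * d⁄dX ℝ r + r * r + r with hs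
  have hcs : ∀ n, 4 * coeff (n + 1) s = 1 := by
    intro n
    induction n with
    | zero =>
      have h := congrArg (coeff 1) hric
      have h0 := congrArg (coeff 0) hric
      rw [mul_sub, mul_one, map_sub, coeff_succ_mul_X, h4, h4, coeff_one_X] at h
      rw [mul_sub, mul_one, map_sub, coeff_zero_mul_X, h4, coeff_zero_X] at h0
      simpa using by linarith
    | succ n ih =>
      have h := congrArg (coeff (n + 2)) hric
      rw [mul_sub, mul_one, map_sub, coeff_succ_mul_X, h4, h4, coeff_X, if_neg (by omega)] at h
      linarith
  cases n with
  | zero => simp [logDerivCoeff_zero]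
  | succ n =>
    have h := hcs n
    rw [hs, map_add, map_add, hθ, coeff_mul] at h
    have hnn : 0 ≤ ∑ p ∈ Finset.HasAntidiagonal.antidiagonal (n + 1), coeff p.1 r * coeff p.2 r := by
      refine Finset.sum_nonneg fun p _ => ?_
      simp only [hr, coeff_mk]
      exact mul_nonneg (logDerivCoeff_signCoeff_nonneg _) (logDerivCoeff_signCoeff_nonneg _)
    simp only [hr, coeff_mk] at h hnn
    linarith

theorem three_mul_logDerivCoeff_le (n : ℕ) :
    3 * logDerivCoeff signCoeff n ≤ logDerivCoeff tailCoeff n := by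
  rcases Nat.eq_zero_or_pos n with rfl | hn
  · simp [logDerivCoeff_zero]
  · refine le_trans ?_ (le_logDerivCoeff_tailCoeff n hn)
    have h := add_one_mul_logDerivCoeff_signCoeff_le n
    rw [le_div_iff₀ (by positivity)]
    linarith

end Riccati

/-! ### Power series as exponentials, up to the endpoint 1. -/

section ExpSeries

theorem hasDerivAt_tsum_mul_pow {a : ℕ → ℝ} {C : ℝ} (ha : ∀ n, |a n| ≤ C) {x : ℝ} (hx : |x| < 1) :
    HasDerivAt (fun y => ∑' n, a n * y ^ n) (∑' n, (n + 1) * a (n + 1) * x ^ n) x := by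
  obtain ⟨ρ, hxρ, hρ1⟩ := exists_between hx
  have hρ0 : 0 ≤ ρ := (abs_nonneg x).trans hxρ.le
  have hC : 0 ≤ C := (abs_nonneg _).trans (ha 0)
  have hsumm : Summable fun n : ℕ => C * (n * ρ ^ (n - 1)) := by
    refine Summable.mul_left C ?_
    rw [← summable_nat_add_iff 1]
    have h1 : Summable fun n : ℕ => (n : ℝ) ^ 1 * ρ ^ n :=
      summable_pow_mul_geometric_of_norm_lt_one 1 (by rwa [Real.norm_of_nonneg hρ0])
    have h2 : Summable fun n : ℕ => ρ ^ n := summable_geometric_of_lt_one hρ0 hρ1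
    refine (h1.add h2).congr fun n => ?_
    simp
    ring
  have h := hasDerivAt_tsum_of_isPreconnected (g := fun n y => a n * y ^ n)
    (g' := fun n y => a n * (n * y ^ (n - 1))) hsumm (t := Metric.ball 0 ρ) Metric.isOpen_ball
    (convex_ball 0 ρ).isPreconnected (fun n y _ => (hasDerivAt_pow n y).const_mul (a n))
    (fun n y hy => ?_) (y₀ := 0) (y := x) (by simpa using (abs_nonneg x).trans_lt hxρ) ?_
    (by simpa using hxρ)
  · refine h.congr_deriv ?_
    have hs : Summable fun n => a n * (n * x ^ (n - 1)) := by
      refine Summable.of_norm_bounded hsumm fun n => ?_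
      simp only [norm_mul, norm_pow, Real.norm_eq_abs, Nat.abs_cast]
      gcongr
      exact ha n
    rw [hs.tsum_eq_zero_add]
    simp only [Nat.cast_zero, zero_mul, mul_zero, zero_add]
    refine tsum_congr fun n => ?_
    simp only [Nat.add_sub_cancel, Nat.cast_add, Nat.cast_one]
    ring
  · have hy' : |y| < ρ := by simpa using hy
    simp only [norm_mul, norm_pow, Real.norm_eq_abs, Nat.abs_cast]
    gcongr
    exact ha n
  · refine summable_of_ne_finset_zero (s := {0}) fun n hn => ?_
    simp only [Finset.mem_singleton] at hn
    simp [hn]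

theorem continuousOn_tsum_mul_pow {a : ℕ → ℝ} (ha : Summable fun n => |a n|) :
    ContinuousOn (fun y : ℝ => ∑' n, a n * y ^ n) (Set.Icc 0 1) := by
  refine continuousOn_tsum (fun n => by fun_prop) ha fun n y hy => ?_
  rw [norm_mul, norm_pow, Real.norm_of_nonneg hy.1]
  exact mul_le_of_le_one_right (norm_nonneg _) (pow_le_one₀ hy.1 hy.2)

variable {g : ℕ → ℝ}

theorem logDerivCoeff_div_le (h0 : g 0 = 1) (hg : ∀ n, 0 ≤ g n)
    (hα : ∀ n, 0 ≤ logDerivCoeff g n) (n : ℕ) : logDerivCoeff g n / n ≤ g n := by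
  rcases Nat.eq_zero_or_pos n with rfl | hn
  · simpa using hg 0
  rw [div_le_iff₀ (by exact_mod_cast hn), mul_comm, ← sum_logDerivCoeff_mul h0,
    Finset.sum_range_succ, Nat.sub_self, h0, mul_one]
  have : 0 ≤ ∑ k ∈ Finset.range n, logDerivCoeff g k * g (n - k) :=
    Finset.sum_nonneg fun k _ => mul_nonneg (hα k) (hg _)
  linarith

theorem summable_logDerivCoeff_div (h0 : g 0 = 1) (hg : ∀ n, 0 ≤ g n) (hs : Summable g)
    (hα : ∀ n, 0 ≤ logDerivCoeff g n) : Summable fun n => logDerivCoeff g n / n :=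
  Summable.of_nonneg_of_le (fun n => div_nonneg (hα n) (Nat.cast_nonneg n))
    (logDerivCoeff_div_le h0 hg hα) hs

/-- A power series is the exponential of the integrated logarithmic derivative. -/
theorem tsum_mul_pow_eq_exp (h0 : g 0 = 1) (hg : ∀ n, 0 ≤ g n) (hs : Summable g)
    (hα : ∀ n, 0 ≤ logDerivCoeff g n) {x : ℝ} (hx : x ∈ Set.Icc (0 : ℝ) 1) :
    ∑' n, g n * x ^ n = Real.exp (∑' n, logDerivCoeff g n / n * x ^ n) := by
  set α := logDerivCoeff g with hαdef
  have hsα := summable_logDerivCoeff_div h0 hg hs hα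
  set f : ℝ → ℝ := fun y => ∑' n, g n * y ^ n with hf
  set A : ℝ → ℝ := fun y => ∑' n, α n / n * y ^ n with hA
  have hfc : ContinuousOn f (Set.Icc 0 1) :=
    continuousOn_tsum_mul_pow (by simpa [abs_of_nonneg, hg] using hs)
  have hAc : ContinuousOn A (Set.Icc 0 1) := by
    refine continuousOn_tsum_mul_pow (hsα.congr fun n => ?_)
    rw [abs_of_nonneg (div_nonneg (hα n) (Nat.cast_nonneg n))]
  have hgb : ∀ n, |g n| ≤ ∑' n, g n := fun n => by
    rw [abs_of_nonneg (hg n)]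
    exact hs.le_tsum n fun k _ => hg k
  have hαb : ∀ n, |α n / n| ≤ ∑' n, g n := fun n => by
    rw [abs_of_nonneg (div_nonneg (hα n) (Nat.cast_nonneg n))]
    exact (logDerivCoeff_div_le h0 hg hα n).trans ((le_abs_self _).trans (hgb n))
  have hderiv : ∀ y ∈ Set.Ico (0 : ℝ) 1, HasDerivAt (fun y => f y * Real.exp (-A y)) 0 y := by
    intro y hy
    have hy1 : |y| < 1 := by rw [abs_of_nonneg hy.1]; exact hy.2
    have hf' := hasDerivAt_tsum_mul_pow hgb hy1
    have hA' := hasDerivAt_tsum_mul_pow hαb hy1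
    have hyn : ∀ n, 0 ≤ y ^ n := fun n => pow_nonneg hy.1 n
    have hsg : Summable fun n => g n * y ^ n :=
      Summable.of_nonneg_of_le (fun n => mul_nonneg (hg n) (hyn n))
        (fun n => mul_le_of_le_one_right (hg n) (pow_le_one₀ hy.1 hy.2.le)) hs
    have hAs : ∀ n : ℕ, ((n : ℝ) + 1) * (α (n + 1) / ((n + 1 : ℕ) : ℝ)) * y ^ n =
        α (n + 1) * y ^ n := by
      intro n
      push_cast
      field_simp
    simp_rw [hAs] at hA'
    have hsα1 : Summable fun n => α (n + 1) * y ^ n := by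
      have h1 : Summable fun n : ℕ => (∑' n, g n) * ((n : ℝ) ^ 1 * y ^ n + y ^ n) :=
        ((summable_pow_mul_geometric_of_norm_lt_one 1 (by simpa using hy1)).add
          (summable_geometric_of_lt_one hy.1 hy.2)).mul_left _
      refine Summable.of_nonneg_of_le (fun n => mul_nonneg (hα _) (hyn n)) (fun n => ?_) h1
      have h2 := (le_abs_self _).trans (hαb (n + 1))
      rw [div_le_iff₀ (by positivity)] at h2
      push_cast at h2
      calc α (n + 1) * y ^ n ≤ ((∑' n, g n) * (n + 1)) * y ^ n :=
            mul_le_mul_of_nonneg_right h2 (hyn n)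
        _ = _ := by ring
    have hprod : ∑' n : ℕ, ((n : ℝ) + 1) * g (n + 1) * y ^ n =
        (∑' n, α (n + 1) * y ^ n) * ∑' n, g n * y ^ n := by
      rw [tsum_mul_tsum_eq_tsum_sum_range_of_summable_norm hsα1.norm hsg.norm]
      refine tsum_congr fun n => ?_
      have h := sum_logDerivCoeff_mul h0 (n + 1)
      rw [Finset.sum_range_succ', logDerivCoeff_zero, zero_mul, add_zero] at h
      push_cast at h
      rw [← h, Finset.sum_mul]
      refine Finset.sum_congr rfl fun k hk => ?_
      rw [Finset.mem_range] at hk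
      rw [show y ^ n = y ^ k * y ^ (n - k) by rw [← pow_add]; congr 1; omega]
      ring
    rw [hprod] at hf'
    refine (hf'.mul hA'.neg.exp).congr_deriv ?_
    ring
  -- The derivative vanishes on [0, 1) only; continuity on [0, 1] brings in the endpoint, which is
  -- needed for G(1).
  have hconst : ∀ y ∈ Set.Icc (0 : ℝ) 1, f y * Real.exp (-A y) = f 0 * Real.exp (-A 0) := by
    refine constant_of_has_deriv_right_zero (hfc.mul (Real.continuous_exp.comp_continuousOn hAc.neg))
      fun y hy => (hderiv y hy).hasDerivWithinAt
  have hf0 : f 0 = 1 := by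
    simp only [hf]
    rw [tsum_eq_single 0 fun n hn => by simp [hn]]
    simp [h0]
  have hA0 : A 0 = 0 := by
    simp only [hA]
    rw [tsum_eq_single 0 fun n hn => by simp [hn]]
    simp
  have h := hconst x hx
  rw [hf0, hA0, neg_zero, Real.exp_zero, mul_one, Real.exp_neg] at h
  have hne := Real.exp_ne_zero (A x)
  field_simp at h
  exact h

end ExpSeries

/-! ### The factorization of G - 1. -/

section Factorization

/-- Raabe's test in telescoping form: each term is at most four times a decrement of n times the
n-th coefficient. -/
theorem summable_signCoeff : Summable signCoeff := by
  rw [← summable_nat_add_iff 1]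
  refine summable_of_sum_range_le (c := 4 * signCoeff 1) (fun n => (signCoeff_pos _).le) fun n => ?_
  suffices ∑ i ∈ Finset.range n, signCoeff (i + 1) ≤
      4 * (signCoeff 1 - ((n : ℝ) + 1) * signCoeff (n + 1)) by
    have h := mul_pos (show (0 : ℝ) < n + 1 by positivity) (signCoeff_pos (n + 1))
    linarith
  induction n with
  | zero => simp
  | succ n ih =>
    rw [Finset.sum_range_succ]
    have h : signCoeff (n + 2) = coeffRatio (n + 1) * signCoeff (n + 1) := rfl
    have h2 : signCoeff (n + 1) ≤ 4 * (((n : ℝ) + 1) * signCoeff (n + 1) -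
        ((n : ℝ) + 2) * signCoeff (n + 2)) := by
      rw [h]
      have h3 : 4 * (((n : ℝ) + 1) - ((n : ℝ) + 2) * coeffRatio (n + 1)) - 1 =
          3 * n / (n + 3) := by
        rw [coeffRatio]
        push_cast
        field_simp
        ring
      have h4 : (0 : ℝ) ≤ 3 * n / (n + 3) := by positivity
      have := mul_nonneg (h3 ▸ h4) (signCoeff_pos (n + 1)).le
      linarith
    push_cast
    rw [show (n : ℝ) + 1 + 1 = n + 2 by ring]
    linarith

theorem summable_tailCoeff : Summable tailCoeff :=
  ((summable_nat_add_iff 1).2 summable_signCoeff).mul_left 8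

/-- `₂F₁(1/2, 1/2; 2; x)`. -/
noncomputable def signSeries (x : ℝ) : ℝ := ∑' n, signCoeff n * x ^ n

/-- The coefficients of `log (8 (G - 1) / (x G ^ 3))`, where `G = signSeries`. -/
noncomputable def quotientLogCoeff (n : ℕ) : ℝ :=
  logDerivCoeff tailCoeff n / n - 3 * (logDerivCoeff signCoeff n / n)

theorem quotientLogCoeff_nonneg (n : ℕ) : 0 ≤ quotientLogCoeff n := by
  rw [quotientLogCoeff, ← mul_div_assoc, ← sub_div]
  exact div_nonneg (sub_nonneg.2 (three_mul_logDerivCoeff_le n)) (Nat.cast_nonneg n)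

theorem logDerivCoeff_tailCoeff_nonneg (n : ℕ) : 0 ≤ logDerivCoeff tailCoeff n :=
  (mul_nonneg zero_le_three (logDerivCoeff_signCoeff_nonneg n)).trans (three_mul_logDerivCoeff_le n)

theorem summable_quotientLogCoeff : Summable quotientLogCoeff :=
  (summable_logDerivCoeff_div tailCoeff_zero (fun n => (tailCoeff_pos n).le) summable_tailCoeff
    logDerivCoeff_tailCoeff_nonneg).sub
  ((summable_logDerivCoeff_div (g := signCoeff) rfl (fun n => (signCoeff_pos n).le)
    summable_signCoeff logDerivCoeff_signCoeff_nonneg).mul_left 3)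

theorem summable_mul_pow_of_summable {a : ℕ → ℝ} (ha : ∀ n, 0 ≤ a n) (hs : Summable a) {x : ℝ}
    (hx : x ∈ Set.Icc (0 : ℝ) 1) : Summable fun n => a n * x ^ n :=
  Summable.of_nonneg_of_le (fun n => mul_nonneg (ha n) (pow_nonneg hx.1 n))
    (fun n => mul_le_of_le_one_right (ha n) (pow_le_one₀ hx.1 hx.2)) hs

theorem signSeries_sub_one {x : ℝ} (hx : x ∈ Set.Icc (0 : ℝ) 1) :
    signSeries x - 1 = x / 8 * signSeries x ^ 3 * Real.exp (∑' n, quotientLogCoeff n * x ^ n) := by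
  have hsc := summable_mul_pow_of_summable (fun n => (signCoeff_pos n).le) summable_signCoeff hx
  have h1 : signSeries x - 1 = x / 8 * ∑' n, tailCoeff n * x ^ n := by
    rw [signSeries, hsc.tsum_eq_zero_add, ← tsum_mul_left]
    simp only [signCoeff, tailCoeff, pow_zero, mul_one, add_sub_cancel_left]
    refine tsum_congr fun n => ?_
    ring
  have hα := summable_mul_pow_of_summable
    (fun n => div_nonneg (logDerivCoeff_tailCoeff_nonneg n) (Nat.cast_nonneg n))
    (summable_logDerivCoeff_div tailCoeff_zero (fun n => (tailCoeff_pos n).le) summable_tailCoeff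
      logDerivCoeff_tailCoeff_nonneg) hx
  have hβ := summable_mul_pow_of_summable
    (fun n => div_nonneg (logDerivCoeff_signCoeff_nonneg n) (Nat.cast_nonneg n))
    (summable_logDerivCoeff_div (g := signCoeff) rfl (fun n => (signCoeff_pos n).le)
      summable_signCoeff logDerivCoeff_signCoeff_nonneg) hx
  have h2 : ∑' n, quotientLogCoeff n * x ^ n = ∑' n, logDerivCoeff tailCoeff n / n * x ^ n -
      3 * ∑' n, logDerivCoeff signCoeff n / n * x ^ n := by
    rw [← tsum_mul_left, ← hα.tsum_sub (hβ.mul_left 3)]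
    refine tsum_congr fun n => ?_
    rw [quotientLogCoeff]
    ring
  rw [h1, h2, tsum_mul_pow_eq_exp tailCoeff_zero (fun n => (tailCoeff_pos n).le)
    summable_tailCoeff logDerivCoeff_tailCoeff_nonneg hx, signSeries,
    tsum_mul_pow_eq_exp (g := signCoeff) rfl (fun n => (signCoeff_pos n).le)
    summable_signCoeff logDerivCoeff_signCoeff_nonneg hx, ← Real.exp_nat_mul, mul_assoc,
    ← Real.exp_add]
  congr 2
  push_cast
  ring

end Factorization

end Grothendieck

namespace Grothendieck

open MeasureTheory ProbabilityTheory

/-! ### Gaussian integrals with a Gaussian weight. -/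

section GaussianIntegrals

/-- Multiplying a standard Gaussian density by `exp (-β (p + σ u) ^ 2 / 2)` gives a multiple of
another Gaussian density. -/
theorem integral_mul_exp_gaussianReal {β : ℝ} (hβ : 0 ≤ β) (σ p : ℝ) (f : ℝ → ℝ) :
    ∫ u, f u * Real.exp (-(β * (p + σ * u) ^ 2 / 2)) ∂(gaussianReal 0 1) =
      √(1 + β * σ ^ 2)⁻¹ * Real.exp (-(β * (1 + β * σ ^ 2)⁻¹ * p ^ 2 / 2)) *
        ∫ u, f u ∂(gaussianReal (-(β * σ * p * (1 + β * σ ^ 2)⁻¹))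
          (Real.toNNReal (1 + β * σ ^ 2)⁻¹)) := by
  set q := 1 + β * σ ^ 2 with hq
  have hq0 : 0 < q := by positivity
  have hv : Real.toNNReal q⁻¹ ≠ 0 := by simpa using hq0
  rw [integral_gaussianReal_eq_integral_smul one_ne_zero, integral_gaussianReal_eq_integral_smul hv,
    ← integral_const_mul]
  refine integral_congr_ae (Filter.Eventually.of_forall fun u => ?_)
  simp only [smul_eq_mul, gaussianPDFReal, Real.coe_toNNReal _ (inv_nonneg.2 hq0.le),
    NNReal.coe_one, mul_one, sub_zero, sub_neg_eq_add]
  have h1 : (√(2 * Real.pi * q⁻¹))⁻¹ = (√(2 * Real.pi))⁻¹ * (√q⁻¹)⁻¹ := by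
    rw [Real.sqrt_mul (by positivity), mul_inv]
  have h2 : √q⁻¹ ≠ 0 := by positivity
  have h3 : -u ^ 2 / 2 + -(β * (p + σ * u) ^ 2 / 2) =
      -(β * q⁻¹ * p ^ 2 / 2) + -(u + β * σ * p * q⁻¹) ^ 2 / (2 * q⁻¹) := by
    field_simp
    rw [hq]
    ring
  have h4 := congrArg Real.exp h3
  rw [Real.exp_add, Real.exp_add] at h4
  rw [h1]
  calc (√(2 * Real.pi))⁻¹ * Real.exp (-u ^ 2 / 2) * (f u * Real.exp (-(β * (p + σ * u) ^ 2 / 2)))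
      = (√(2 * Real.pi))⁻¹ * f u * (Real.exp (-u ^ 2 / 2) *
          Real.exp (-(β * (p + σ * u) ^ 2 / 2))) := by ring
    _ = _ := by
      rw [h4]
      field_simp

theorem integral_exp_gaussianReal {β : ℝ} (hβ : 0 ≤ β) (σ p : ℝ) :
    ∫ u, Real.exp (-(β * (p + σ * u) ^ 2 / 2)) ∂(gaussianReal 0 1) =
      √(1 + β * σ ^ 2)⁻¹ * Real.exp (-(β * (1 + β * σ ^ 2)⁻¹ * p ^ 2 / 2)) := by
  simpa using integral_mul_exp_gaussianReal hβ σ p (fun _ => 1)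

theorem integral_linear_mul_exp_gaussianReal {β : ℝ} (hβ : 0 ≤ β) (σ p : ℝ) :
    ∫ u, (p + σ * u) * Real.exp (-(β * (p + σ * u) ^ 2 / 2)) ∂(gaussianReal 0 1) =
      p * (1 + β * σ ^ 2)⁻¹ *
        (√(1 + β * σ ^ 2)⁻¹ * Real.exp (-(β * (1 + β * σ ^ 2)⁻¹ * p ^ 2 / 2))) := by
  have hq0 : 0 < 1 + β * σ ^ 2 := by positivity
  have hi : ∀ (m : ℝ) (v : NNReal), Integrable (fun u : ℝ => σ * u) (gaussianReal m v) :=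
    fun m v => IsGaussian.integrable_id.const_mul σ
  rw [integral_mul_exp_gaussianReal hβ σ p (fun u => p + σ * u),
    integral_add (integrable_const p) (hi _ _), integral_const_mul]
  have : ∀ (m : ℝ) (v : NNReal), ∫ u, u ∂(gaussianReal m v) = m := fun m v =>
    integral_id_gaussianReal
  rw [this]
  simp only [integral_const, probReal_univ, smul_eq_mul, one_mul]
  field_simp
  ring

theorem integral_sq_mul_exp_gaussianReal {β : ℝ} (hβ : 0 ≤ β) :
    ∫ u, u ^ 2 * Real.exp (-(β * u ^ 2 / 2)) ∂(gaussianReal 0 1) =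
      (1 + β)⁻¹ * √(1 + β)⁻¹ := by
  have h := integral_mul_exp_gaussianReal hβ 1 0 (fun u => u ^ 2)
  simp only [zero_add, one_mul, one_pow, mul_one, mul_zero, zero_mul, neg_zero] at h
  rw [h]
  have h2 := variance_id_gaussianReal (μ := 0) (v := Real.toNNReal (1 + β)⁻¹)
  rw [variance_of_integral_eq_zero (by fun_prop) (by simp)] at h2
  simp only [id_eq, Real.coe_toNNReal _ (show 0 ≤ (1 + β)⁻¹ by positivity)] at h2
  rw [h2]
  simp
  ring

theorem integral_sq_norm_mul_exp_stdGaussian {A : ℝ} (hA : 0 ≤ A) :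
    ∫ w : ℂ, ‖w‖ ^ 2 * Real.exp (-(A * ‖w‖ ^ 2 / 2)) ∂(stdGaussian ℂ) = 2 / (1 + A) ^ 2 := by
  have hA1 : 0 < 1 + A := by positivity
  have hnorm : ∀ q : ℝ × ℝ, ‖(q.1 : ℂ) + q.2 * Complex.I‖ ^ 2 = q.1 ^ 2 + q.2 ^ 2 := by
    intro q
    rw [Complex.sq_norm, Complex.normSq_add_mul_I]
  rw [stdGaussian_complex, integral_map (by fun_prop) (by fun_prop)]
  have hsplit : ∀ q : ℝ × ℝ, ‖(q.1 : ℂ) + q.2 * Complex.I‖ ^ 2 *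
      Real.exp (-(A * ‖(q.1 : ℂ) + q.2 * Complex.I‖ ^ 2 / 2)) =
      (q.1 ^ 2 * Real.exp (-(A * q.1 ^ 2 / 2))) * Real.exp (-(A * q.2 ^ 2 / 2)) +
      Real.exp (-(A * q.1 ^ 2 / 2)) * (q.2 ^ 2 * Real.exp (-(A * q.2 ^ 2 / 2))) := by
    intro q
    rw [hnorm, show -(A * (q.1 ^ 2 + q.2 ^ 2) / 2) = -(A * q.1 ^ 2 / 2) + -(A * q.2 ^ 2 / 2) by ring,
      Real.exp_add]
    ring
  simp_rw [hsplit]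
  have hi1 : Integrable (fun u : ℝ => Real.exp (-(A * u ^ 2 / 2))) (gaussianReal 0 1) := by
    refine Integrable.of_bound (by fun_prop) 1 (Filter.Eventually.of_forall fun u => ?_)
    rw [Real.norm_eq_abs, Real.abs_exp, Real.exp_le_one_iff]
    have : 0 ≤ A * u ^ 2 / 2 := by positivity
    linarith
  have hsqi : Integrable (fun u : ℝ => u ^ 2) (gaussianReal 0 1) :=
    (IsGaussian.memLp_two_id (μ := gaussianReal 0 1)).integrable_sq
  have hi2 : Integrable (fun u : ℝ => u ^ 2 * Real.exp (-(A * u ^ 2 / 2))) (gaussianReal 0 1) := by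
    refine hsqi.mono (by fun_prop) (Filter.Eventually.of_forall fun u => ?_)
    rw [norm_mul]
    refine mul_le_of_le_one_right (norm_nonneg _) ?_
    rw [Real.norm_eq_abs, Real.abs_exp, Real.exp_le_one_iff]
    have : 0 ≤ A * u ^ 2 / 2 := by positivity
    linarith
  rw [integral_add (hi2.mul_prod hi1) (hi1.mul_prod hi2),
    integral_prod_mul (fun u : ℝ => u ^ 2 * Real.exp (-(A * u ^ 2 / 2)))
      (fun u : ℝ => Real.exp (-(A * u ^ 2 / 2))),
    integral_prod_mul (fun u : ℝ => Real.exp (-(A * u ^ 2 / 2)))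
      (fun u : ℝ => u ^ 2 * Real.exp (-(A * u ^ 2 / 2))),
    integral_sq_mul_exp_gaussianReal hA]
  have h0 := integral_exp_gaussianReal hA 1 0
  simp only [zero_add, one_mul, one_pow, mul_one, ne_eq, OfNat.ofNat_ne_zero, not_false_eq_true,
    zero_pow, mul_zero, zero_div, neg_zero, Real.exp_zero] at h0
  rw [h0]
  have hs : √(1 + A)⁻¹ * √(1 + A)⁻¹ = (1 + A)⁻¹ := Real.mul_self_sqrt (by positivity)
  calc _ = 2 * (1 + A)⁻¹ * (√(1 + A)⁻¹ * √(1 + A)⁻¹) := by ring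
    _ = _ := by
      rw [hs]
      field_simp

theorem integral_conj_mul_exp_stdGaussian {β : ℝ} (hβ : 0 < β) (σ : ℝ) (c : ℂ) :
    ∫ w : ℂ, star (c + σ • w) * (Real.exp (-(β * ‖c + σ • w‖ ^ 2 / 2)) : ℝ) ∂(stdGaussian ℂ) =
      star c * (((1 + β * σ ^ 2)⁻¹ ^ 2 *
        Real.exp (-(β * (1 + β * σ ^ 2)⁻¹ * ‖c‖ ^ 2 / 2)) : ℝ) : ℂ) := by
  set κ := (1 + β * σ ^ 2)⁻¹ with hκ
  have hκ0 : 0 ≤ κ := by positivity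
  rw [stdGaussian_complex, integral_map (by fun_prop) (by fun_prop)]
  set E : ℝ → ℝ → ℝ := fun p u => Real.exp (-(β * (p + σ * u) ^ 2 / 2)) with hE
  have hsplit : ∀ q : ℝ × ℝ, star (c + σ • ((q.1 : ℂ) + q.2 * Complex.I)) *
      (Real.exp (-(β * ‖c + σ • ((q.1 : ℂ) + q.2 * Complex.I)‖ ^ 2 / 2)) : ℝ) =
      ((((c.re + σ * q.1) * E c.re q.1) * E c.im q.2 : ℝ) : ℂ) -
      ((E c.re q.1 * ((c.im + σ * q.2) * E c.im q.2) : ℝ) : ℂ) * Complex.I := by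
    intro q
    have e1 : c + σ • ((q.1 : ℂ) + q.2 * Complex.I) =
        ((c.re + σ * q.1 : ℝ) : ℂ) + ((c.im + σ * q.2 : ℝ) : ℂ) * Complex.I := by
      rw [Complex.real_smul]
      conv_lhs => rw [← Complex.re_add_im c]
      push_cast
      ring
    rw [e1, Complex.sq_norm, Complex.normSq_add_mul_I,
      show -(β * ((c.re + σ * q.1) ^ 2 + (c.im + σ * q.2) ^ 2) / 2) =
        -(β * (c.re + σ * q.1) ^ 2 / 2) + -(β * (c.im + σ * q.2) ^ 2 / 2) by ring, Real.exp_add]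
    simp only [hE, Complex.star_def, map_add, map_mul, Complex.conj_ofReal, Complex.conj_I]
    push_cast
    ring
  simp_rw [hsplit]
  have hi0 : ∀ p, Integrable (E p) (gaussianReal 0 1) := by
    intro p
    refine Integrable.of_bound (by fun_prop) 1 (Filter.Eventually.of_forall fun u => ?_)
    rw [Real.norm_eq_abs, Real.abs_exp, Real.exp_le_one_iff]
    have : 0 ≤ β * (p + σ * u) ^ 2 / 2 := by positivity
    linarith
  have hi1 : ∀ p, Integrable (fun u => (p + σ * u) * E p u) (gaussianReal 0 1) := by
    intro p
    have : Integrable (fun u : ℝ => p + σ * u) (gaussianReal 0 1) :=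
      (integrable_const p).add (IsGaussian.integrable_id.const_mul σ)
    refine this.mono (by fun_prop) (Filter.Eventually.of_forall fun u => ?_)
    rw [norm_mul]
    refine mul_le_of_le_one_right (norm_nonneg _) ?_
    rw [Real.norm_eq_abs, Real.abs_exp, Real.exp_le_one_iff]
    have : 0 ≤ β * (p + σ * u) ^ 2 / 2 := by positivity
    linarith
  rw [integral_sub ((hi1 c.re).mul_prod (hi0 c.im)).ofReal
    (((hi0 c.re).mul_prod (hi1 c.im)).ofReal.mul_const _), integral_mul_const,
    integral_complex_ofReal, integral_complex_ofReal,
    integral_prod_mul (fun u => (c.re + σ * u) * E c.re u) (E c.im),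
    integral_prod_mul (E c.re) (fun u => (c.im + σ * u) * E c.im u)]
  simp only [hE]
  rw [integral_linear_mul_exp_gaussianReal hβ.le, integral_linear_mul_exp_gaussianReal hβ.le,
    integral_exp_gaussianReal hβ.le, integral_exp_gaussianReal hβ.le, ← hκ]
  have hs : √κ * √κ = κ := Real.mul_self_sqrt hκ0
  have hexp : Real.exp (-(β * κ * ‖c‖ ^ 2 / 2)) =
      Real.exp (-(β * κ * c.re ^ 2 / 2)) * Real.exp (-(β * κ * c.im ^ 2 / 2)) := by
    rw [← Real.exp_add, Complex.sq_norm, Complex.normSq_apply]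
    congr 1
    ring
  set X := Real.exp (-(β * κ * c.re ^ 2 / 2))
  set Y := Real.exp (-(β * κ * c.im ^ 2 / 2))
  rw [hexp, show c.re * κ * (√κ * X) * (√κ * Y) = c.re * (κ ^ 2 * (X * Y)) by
      linear_combination c.re * κ * X * Y * hs,
    show √κ * X * (c.im * κ * (√κ * Y)) = c.im * (κ ^ 2 * (X * Y)) by
      linear_combination c.im * κ * X * Y * hs]
  have hc : star c = (c.re : ℂ) - c.im * Complex.I := by
    apply Complex.ext <;> simp
  rw [hc]
  push_cast
  ring

end GaussianIntegrals

end Grothendieck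

namespace Grothendieck

open MeasureTheory ProbabilityTheory

/-! ### Rational integrals that produce the coefficients of G. -/

section RationalIntegrals

theorem pow_div_one_add_sq_pow_le (n : ℕ) (a : ℝ) :
    a ^ (2 * n) / (1 + a ^ 2) ^ (n + 2) ≤ (1 + a ^ 2)⁻¹ := by
  have h0 : 0 < 1 + a ^ 2 := by positivity
  have h1 : (a ^ 2) ^ n ≤ (1 + a ^ 2) ^ n := pow_le_pow_left₀ (sq_nonneg a) (by linarith) n
  rw [div_le_iff₀ (by positivity), pow_mul, pow_add, pow_two (1 + a ^ 2)]
  calc (a ^ 2) ^ n ≤ (1 + a ^ 2) ^ n * 1 := by simpa using h1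
    _ ≤ (1 + a ^ 2) ^ n * (1 + a ^ 2) :=
      mul_le_mul_of_nonneg_left (by nlinarith [sq_nonneg a]) (by positivity)
    _ = _ := by field_simp

theorem integrableOn_pow_div_one_add_sq_pow (n : ℕ) :
    IntegrableOn (fun a : ℝ => a ^ (2 * n) / (1 + a ^ 2) ^ (n + 2)) (Set.Ioi 0) := by
  refine (integrable_inv_one_add_sq.mono ?_ (Filter.Eventually.of_forall fun a => ?_)).integrableOn
  · refine Continuous.aestronglyMeasurable ?_
    exact Continuous.div (by fun_prop) (by fun_prop) fun a => by positivity
  · rw [Real.norm_of_nonneg (by rw [pow_mul]; positivity), Real.norm_of_nonneg (by positivity)]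
    exact pow_div_one_add_sq_pow_le n a

/-- The integrals `∫₀^∞ a^(2n) / (1 + a²)^(n+2) da`. -/
noncomputable def rationalIntegral (n : ℕ) : ℝ :=
  ∫ a in Set.Ioi (0 : ℝ), a ^ (2 * n) / (1 + a ^ 2) ^ (n + 2)

theorem rationalIntegral_zero : rationalIntegral 0 = Real.pi / 4 := by
  have hd : ∀ a ∈ Set.Ici (0 : ℝ), HasDerivAt (fun a => (a / (1 + a ^ 2) + Real.arctan a) / 2)
      (a ^ (2 * 0) / (1 + a ^ 2) ^ (0 + 2)) a := by
    intro a _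
    have h0 : 1 + a ^ 2 ≠ 0 := by positivity
    have h1 : HasDerivAt (fun a : ℝ => 1 + a ^ 2) (2 * a) a := by
      simpa using (hasDerivAt_pow 2 a).const_add 1
    refine ((((hasDerivAt_id a).div h1 h0).add (Real.hasDerivAt_arctan a)).div_const 2).congr_deriv ?_
    simp only [id_eq]
    field_simp
    ring
  have hlim : Filter.Tendsto (fun a : ℝ => (a / (1 + a ^ 2) + Real.arctan a) / 2) Filter.atTop
      (nhds ((0 + Real.pi / 2) / 2)) := by
    refine (Filter.Tendsto.add ?_ (Real.tendsto_arctan_atTop.mono_right nhdsWithin_le_nhds)).div_const 2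
    refine squeeze_zero' (g := fun a : ℝ => a⁻¹) ?_ ?_ tendsto_inv_atTop_zero
    · filter_upwards [Filter.eventually_gt_atTop 0] with a ha
      positivity
    · filter_upwards [Filter.eventually_gt_atTop 0] with a ha
      rw [div_le_iff₀ (by positivity)]
      field_simp
      nlinarith
  rw [rationalIntegral, integral_Ioi_of_hasDerivAt_of_tendsto' hd
    (integrableOn_pow_div_one_add_sq_pow 0) hlim]
  simp
  ring

/-- The function a^(2n+1) / (1 + a²)^(n+2) vanishes at 0 and at infinity, so its derivative
integrates to 0. -/
theorem rationalIntegral_succ (n : ℕ) :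
    (2 * n + 4) * rationalIntegral (n + 1) = (2 * n + 1) * rationalIntegral n := by
  have hd : ∀ a ∈ Set.Ici (0 : ℝ), HasDerivAt (fun a => a ^ (2 * n + 1) / (1 + a ^ 2) ^ (n + 2))
      ((2 * n + 1) * (a ^ (2 * n) / (1 + a ^ 2) ^ (n + 2)) -
        (2 * n + 4) * (a ^ (2 * (n + 1)) / (1 + a ^ 2) ^ (n + 1 + 2))) a := by
    intro a _
    have h0 : 1 + a ^ 2 ≠ 0 := by positivity
    have h1 : HasDerivAt (fun a : ℝ => 1 + a ^ 2) (2 * a) a := by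
      simpa using (hasDerivAt_pow 2 a).const_add 1
    refine ((hasDerivAt_pow (2 * n + 1) a).div (h1.fun_pow (n + 2)) (by positivity)).congr_deriv ?_
    simp only [Nat.add_sub_cancel, show n + 2 - 1 = n + 1 from rfl]
    push_cast
    field_simp
    ring
  have hlim : Filter.Tendsto (fun a : ℝ => a ^ (2 * n + 1) / (1 + a ^ 2) ^ (n + 2)) Filter.atTop
      (nhds 0) := by
    refine squeeze_zero' (g := fun a : ℝ => a⁻¹) ?_ ?_ tendsto_inv_atTop_zero
    · filter_upwards [Filter.eventually_gt_atTop 0] with a ha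
      positivity
    · filter_upwards [Filter.eventually_gt_atTop 0] with a ha
      rw [div_le_iff₀ (by positivity), inv_mul_eq_div, le_div_iff₀ ha, ← pow_succ,
        show 2 * n + 1 + 1 = 2 * (n + 1) by ring, pow_mul]
      calc (a ^ 2) ^ (n + 1) ≤ (1 + a ^ 2) ^ (n + 1) :=
            pow_le_pow_left₀ (sq_nonneg a) (by linarith) _
        _ ≤ (1 + a ^ 2) ^ (n + 2) := pow_le_pow_right₀ (by nlinarith [sq_nonneg a]) (by omega)
  have h1 := (integrableOn_pow_div_one_add_sq_pow n).const_mul (2 * n + 1 : ℝ)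
  have h2 := (integrableOn_pow_div_one_add_sq_pow (n + 1)).const_mul (2 * n + 4 : ℝ)
  have h := integral_Ioi_of_hasDerivAt_of_tendsto' hd (h1.sub h2) hlim
  rw [integral_sub h1 h2, integral_const_mul, integral_const_mul] at h
  simp only [rationalIntegral]
  simp at h
  linarith

theorem add_one_mul_rationalIntegral_sq (n : ℕ) :
    (n + 1) * rationalIntegral n ^ 2 = (Real.pi / 4) ^ 2 * signCoeff n := by
  induction n with
  | zero => simp [rationalIntegral_zero, signCoeff]
  | succ n ih =>
    have h : rationalIntegral (n + 1) = (2 * n + 1) / (2 * n + 4) * rationalIntegral n := by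
      rw [div_mul_eq_mul_div, eq_div_iff (by positivity), ← rationalIntegral_succ]
      ring
    rw [h, signCoeff, mul_left_comm, ← ih, coeffRatio]
    push_cast
    field_simp
    ring

/-- The double integral of `((1 + a²)(1 + b²) - a² b² x)⁻²` over the positive quadrant. -/
theorem integral_inv_sq_eq_signSeries {x : ℝ} (hx : x ∈ Set.Icc (0 : ℝ) 1) :
    ∫ p : ℝ × ℝ, ((1 + p.1 ^ 2) * (1 + p.2 ^ 2) - p.1 ^ 2 * p.2 ^ 2 * x)⁻¹ ^ 2
      ∂((volume.restrict (Set.Ioi 0)).prod (volume.restrict (Set.Ioi 0))) =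
      (Real.pi / 4) ^ 2 * signSeries x := by
  set ν : Measure ℝ := volume.restrict (Set.Ioi 0)
  let f : ℕ → ℝ → ℝ := fun n a => a ^ (2 * n) / (1 + a ^ 2) ^ (n + 2)
  let F : ℕ → ℝ × ℝ → ℝ := fun n p => (n + 1) * x ^ n * (f n p.1 * f n p.2)
  have hf0 : ∀ n a, 0 ≤ f n a := fun n a => by
    simp only [f, pow_mul]
    positivity
  have hF0 : ∀ n p, 0 ≤ F n p := fun n p =>
    mul_nonneg (mul_nonneg (by positivity) (pow_nonneg hx.1 n)) (mul_nonneg (hf0 _ _) (hf0 _ _))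
  have hFi : ∀ n, Integrable (F n) (ν.prod ν) := fun n =>
    ((integrableOn_pow_div_one_add_sq_pow n).mul_prod
      (integrableOn_pow_div_one_add_sq_pow n)).const_mul _
  have hFint : ∀ n, ∫ p, F n p ∂(ν.prod ν) = (Real.pi / 4) ^ 2 * (signCoeff n * x ^ n) := by
    intro n
    simp only [F]
    rw [integral_const_mul, integral_prod_mul (f n) (f n)]
    change (n + 1) * x ^ n * (rationalIntegral n * rationalIntegral n) = _
    linear_combination x ^ n * add_one_mul_rationalIntegral_sq n
  have hsum : Summable fun n => signCoeff n * x ^ n :=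
    summable_mul_pow_of_summable (fun n => (signCoeff_pos n).le) summable_signCoeff hx
  have h := hasSum_integral_of_summable_integral_norm hFi (by
    simp_rw [fun n p => Real.norm_of_nonneg (hF0 n p), hFint]
    exact hsum.mul_left _)
  simp_rw [hFint] at h
  rw [signSeries, ← tsum_mul_left, h.tsum_eq]
  refine integral_congr_ae (Filter.Eventually.of_forall fun p => ?_)
  set A := 1 + p.1 ^ 2 with hA
  set B := 1 + p.2 ^ 2 with hB
  have hA0 : 0 < A := by positivity
  have hB0 : 0 < B := by positivity
  set r := p.1 ^ 2 * p.2 ^ 2 * x / (A * B) with hr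
  have hr0 : 0 ≤ r := div_nonneg (mul_nonneg (by positivity) hx.1) (by positivity)
  have hlt : p.1 ^ 2 * p.2 ^ 2 * x < A * B := by
    have : p.1 ^ 2 * p.2 ^ 2 * x ≤ p.1 ^ 2 * p.2 ^ 2 :=
      mul_le_of_le_one_right (by positivity) hx.2
    have : p.1 ^ 2 * p.2 ^ 2 < A * B := by
      rw [hA, hB]
      nlinarith [sq_nonneg p.1, sq_nonneg p.2]
    linarith
  have hr1 : r < 1 := (div_lt_one (by positivity)).2 hlt
  -- The expansion (1 - r)⁻² = Σ (n + 1) rⁿ separates the variables, and each term is a square of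
  -- `rationalIntegral n`.
  have hg := hasSum_choose_mul_geometric_of_norm_lt_one 1
    (show ‖r‖ < 1 by rwa [Real.norm_of_nonneg hr0])
  have hD : A * B - p.1 ^ 2 * p.2 ^ 2 * x ≠ 0 := (sub_pos.2 hlt).ne'
  have hval : (A * B - p.1 ^ 2 * p.2 ^ 2 * x)⁻¹ ^ 2 =
      ((A * B) ^ 2)⁻¹ * (1 / (1 - r) ^ (1 + 1)) := by
    have : 1 - r = (A * B - p.1 ^ 2 * p.2 ^ 2 * x) / (A * B) := by
      rw [hr]
      field_simp
    rw [this, one_add_one_eq_two]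
    field_simp
  simp only
  rw [hval, ← hg.tsum_eq, ← tsum_mul_left]
  refine tsum_congr fun n => ?_
  simp only [F, f, Nat.choose_one_right, hr, ← hA, ← hB]
  push_cast
  rw [pow_mul, pow_mul]
  simp only [div_pow, mul_pow, pow_add]
  field_simp

end RationalIntegrals

/-! ### Correlation of complex Gaussian phases. -/

section ComplexSign

/-- Writing the phase as a mixture of Gaussian-damped linear functions reduces its expectations to
explicit Gaussian integrals. -/
theorem integral_mul_exp_Ioi (w : ℂ) :
    ∫ a in Set.Ioi (0 : ℝ), (Real.exp (-(a ^ 2 * ‖w‖ ^ 2 / 2)) : ℂ) * w =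
      √(Real.pi / 2) * unimodularSign w := by
  rw [integral_mul_const, integral_complex_ofReal]
  have h : ∀ a : ℝ, -(a ^ 2 * ‖w‖ ^ 2 / 2) = -(‖w‖ ^ 2 / 2) * a ^ 2 := fun a => by ring
  simp_rw [h]
  rw [integral_gaussian_Ioi, unimodularSign]
  have : √(Real.pi / (‖w‖ ^ 2 / 2)) / 2 = √(Real.pi / 2) * ‖w‖⁻¹ := by
    rw [show Real.pi / (‖w‖ ^ 2 / 2) = Real.pi / 2 * (2 * ‖w‖⁻¹) ^ 2 by ring,
      Real.sqrt_mul (by positivity), Real.sqrt_sq (by positivity)]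
    ring
  rw [this]
  simp only [RCLike.ofReal_eq_complex_ofReal]
  push_cast
  ring

theorem integrableOn_mul_exp_Ioi (w : ℂ) :
    IntegrableOn (fun a : ℝ => (Real.exp (-(a ^ 2 * ‖w‖ ^ 2 / 2)) : ℂ) * w) (Set.Ioi 0) := by
  by_cases hw : w = 0
  · simp [hw]
  have h : ∀ a : ℝ, -(a ^ 2 * ‖w‖ ^ 2 / 2) = -(‖w‖ ^ 2 / 2) * a ^ 2 := fun a => by ring
  simp_rw [h]
  exact ((integrable_exp_neg_mul_sq (by positivity)).ofReal.mul_const w).integrableOn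

theorem integral_norm_mul_exp_Ioi_le (w : ℂ) :
    ∫ a in Set.Ioi (0 : ℝ), ‖(Real.exp (-(a ^ 2 * ‖w‖ ^ 2 / 2)) : ℂ) * w‖ ≤ √(Real.pi / 2) := by
  have h1 : ∀ a : ℝ, ‖(Real.exp (-(a ^ 2 * ‖w‖ ^ 2 / 2)) : ℂ) * w‖ =
      Real.exp (-(‖w‖ ^ 2 / 2) * a ^ 2) * ‖w‖ := by
    intro a
    rw [norm_mul, Complex.norm_real, Real.norm_eq_abs, Real.abs_exp]
    congr 2
    ring
  simp_rw [h1]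
  rw [integral_mul_const, integral_gaussian_Ioi,
    show Real.pi / (‖w‖ ^ 2 / 2) = Real.pi / 2 * (2 * ‖w‖⁻¹) ^ 2 by ring,
      Real.sqrt_mul (by positivity), Real.sqrt_sq (by positivity)]
  calc _ = √(Real.pi / 2) * (‖w‖⁻¹ * ‖w‖) := by ring
    _ ≤ √(Real.pi / 2) * 1 := mul_le_mul_of_nonneg_left inv_mul_le_one (by positivity)
    _ = _ := mul_one _

theorem integral_integral_mul_exp_stdGaussian {ζ : ℂ} {σ a b : ℝ} (h : ‖ζ‖ ^ 2 + σ ^ 2 = 1)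
    (hb : 0 < b) :
    ∫ u : ℂ, ∫ v : ℂ, (Real.exp (-(a ^ 2 * ‖u‖ ^ 2 / 2)) : ℂ) * u *
      star ((Real.exp (-(b ^ 2 * ‖ζ * u + σ • v‖ ^ 2 / 2)) : ℂ) * (ζ * u + σ • v))
      ∂(stdGaussian ℂ) ∂(stdGaussian ℂ) =
    star ζ * ((2 * ((1 + a ^ 2) * (1 + b ^ 2) - a ^ 2 * b ^ 2 * ‖ζ‖ ^ 2)⁻¹ ^ 2 : ℝ) : ℂ) := by
  set κ := (1 + b ^ 2 * σ ^ 2)⁻¹ with hκ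
  have hκ0 : 0 < κ := by positivity
  have hin : ∀ u : ℂ, ∫ v : ℂ, (Real.exp (-(a ^ 2 * ‖u‖ ^ 2 / 2)) : ℂ) * u *
      star ((Real.exp (-(b ^ 2 * ‖ζ * u + σ • v‖ ^ 2 / 2)) : ℂ) * (ζ * u + σ • v))
      ∂(stdGaussian ℂ) = star ζ * (κ ^ 2 : ℝ) *
        ((‖u‖ ^ 2 * Real.exp (-((a ^ 2 + b ^ 2 * κ * ‖ζ‖ ^ 2) * ‖u‖ ^ 2 / 2)) : ℝ) : ℂ) := by
    intro u
    have h0 : ∀ v : ℂ, star ((Real.exp (-(b ^ 2 * ‖ζ * u + σ • v‖ ^ 2 / 2)) : ℂ) *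
        (ζ * u + σ • v)) = star (ζ * u + σ • v) *
          (Real.exp (-(b ^ 2 * ‖ζ * u + σ • v‖ ^ 2 / 2)) : ℝ) := by
      intro v
      rw [star_mul]
      congr 1
      exact Complex.conj_ofReal _
    simp_rw [h0]
    rw [integral_const_mul, integral_conj_mul_exp_stdGaussian (by positivity), ← hκ, norm_mul,
      mul_pow, show -((a ^ 2 + b ^ 2 * κ * ‖ζ‖ ^ 2) * ‖u‖ ^ 2 / 2) =
        -(a ^ 2 * ‖u‖ ^ 2 / 2) + -(b ^ 2 * κ * (‖ζ‖ ^ 2 * ‖u‖ ^ 2) / 2) by ring, Real.exp_add]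
    have hu : u * star u = ((‖u‖ ^ 2 : ℝ) : ℂ) := by
      rw [Complex.star_def, Complex.mul_conj, Complex.normSq_eq_norm_sq]
    rw [star_mul, Complex.ofReal_mul, Complex.ofReal_mul, Complex.ofReal_mul, ← hu]
    ring
  simp_rw [hin]
  rw [integral_const_mul, integral_complex_ofReal,
    integral_sq_norm_mul_exp_stdGaussian (by positivity), mul_assoc, ← Complex.ofReal_mul]
  congr 2
  have e : (1 + a ^ 2) * (1 + b ^ 2) - a ^ 2 * b ^ 2 * ‖ζ‖ ^ 2 =
      κ⁻¹ * (1 + (a ^ 2 + b ^ 2 * κ * ‖ζ‖ ^ 2)) := by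
    have : κ⁻¹ * κ = 1 := inv_mul_cancel₀ hκ0.ne'
    have h3 : κ⁻¹ = 1 + b ^ 2 * σ ^ 2 := by rw [hκ, inv_inv]
    linear_combination (-b ^ 2 * ‖ζ‖ ^ 2) * this - (1 + a ^ 2) * h3 - b ^ 2 * (1 + a ^ 2) * h
  rw [e, mul_inv, inv_inv]
  generalize 1 + (a ^ 2 + b ^ 2 * κ * ‖ζ‖ ^ 2) = X
  ring

/-- The correlation of the unimodular signs of two jointly Gaussian complex variables. -/
theorem integral_integral_unimodularSign_complex {ζ : ℂ} {σ : ℝ} (h : ‖ζ‖ ^ 2 + σ ^ 2 = 1) :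
    ∫ w : ℂ × ℂ, unimodularSign w.1 * star (unimodularSign (ζ * w.1 + σ • w.2))
      ∂((stdGaussian ℂ).prod (stdGaussian ℂ)) =
    star ζ * ((Real.pi / 4 * signSeries (‖ζ‖ ^ 2) : ℝ) : ℂ) := by
  set μ := (stdGaussian ℂ).prod (stdGaussian ℂ)
  set ν : Measure ℝ := volume.restrict (Set.Ioi 0)
  let g : ℝ → ℂ → ℂ := fun a w => (Real.exp (-(a ^ 2 * ‖w‖ ^ 2 / 2)) : ℂ) * w
  let F : ℂ × ℂ → ℝ × ℝ → ℂ := fun w p => g p.1 w.1 * star (g p.2 (ζ * w.1 + σ • w.2))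
  have hFc : Continuous (Function.uncurry F) := by
    simp only [Function.uncurry_def, F, g]
    fun_prop
  have hgi : ∀ w, Integrable (fun a => g a w) ν := integrableOn_mul_exp_Ioi
  have hgs : ∀ w, Integrable (fun a => star (g a w)) ν := fun w =>
    (Complex.conjLIE.toContinuousLinearEquiv.toContinuousLinearMap.integrable_comp (hgi w))
  have hnorm : ∀ w, ∫ a, ‖g a w‖ ∂ν ≤ √(Real.pi / 2) := integral_norm_mul_exp_Ioi_le
  have hg : ∀ w, ∫ a, g a w ∂ν = √(Real.pi / 2) * unimodularSign w := integral_mul_exp_Ioi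
  have hInt : Integrable (Function.uncurry F) (μ.prod (ν.prod ν)) := by
    rw [integrable_prod_iff hFc.aestronglyMeasurable]
    refine ⟨Filter.Eventually.of_forall fun w => (hgi w.1).mul_prod (hgs (ζ * w.1 + σ • w.2)), ?_⟩
    refine Integrable.of_bound (hFc.norm.stronglyMeasurable.integral_prod_right').aestronglyMeasurable
      (√(Real.pi / 2) * √(Real.pi / 2)) (Filter.Eventually.of_forall fun w => ?_)
    rw [Real.norm_of_nonneg (integral_nonneg fun p => norm_nonneg _)]
    simp only [Function.uncurry, F, norm_mul, norm_star]
    rw [integral_prod_mul (fun a => ‖g a w.1‖) (fun a => ‖g a (ζ * w.1 + σ • w.2)‖)]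
    exact mul_le_mul (hnorm _) (hnorm _)
      (integral_nonneg fun p => norm_nonneg _) (by positivity)
  have hswap := integral_integral_swap hInt
  have hl : ∀ w : ℂ × ℂ, ∫ p, F w p ∂(ν.prod ν) = ((Real.pi / 2 : ℝ) : ℂ) *
      (unimodularSign w.1 * star (unimodularSign (ζ * w.1 + σ • w.2))) := by
    intro w
    simp only [F]
    rw [integral_prod_mul (fun a => g a w.1) (fun a => star (g a (ζ * w.1 + σ • w.2)))]
    have h1 : ∫ a, star (g a (ζ * w.1 + σ • w.2)) ∂ν = star (∫ a, g a (ζ * w.1 + σ • w.2) ∂ν) :=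
      integral_conj
    rw [h1, hg, hg, star_mul]
    have h2 : star ((√(Real.pi / 2) : ℝ) : ℂ) = (√(Real.pi / 2) : ℝ) := Complex.conj_ofReal _
    have h3 : ((√(Real.pi / 2) : ℝ) : ℂ) * (√(Real.pi / 2) : ℝ) = ((Real.pi / 2 : ℝ) : ℂ) := by
      rw [← Complex.ofReal_mul, Real.mul_self_sqrt (by positivity)]
    rw [h2, ← h3]
    ring
  have hr : ∫ p, ∫ w, F w p ∂μ ∂(ν.prod ν) =
      star ζ * ((2 * ((Real.pi / 4) ^ 2 * signSeries (‖ζ‖ ^ 2)) : ℝ) : ℂ) := by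
    have hx : ‖ζ‖ ^ 2 ∈ Set.Icc (0 : ℝ) 1 := ⟨by positivity, by nlinarith [sq_nonneg σ]⟩
    rw [← integral_inv_sq_eq_signSeries hx, ← integral_const_mul, ← integral_complex_ofReal,
      ← integral_const_mul]
    -- The explicit Gaussian integral requires a positive second parameter.
    have hpos : ∀ᵐ p ∂(ν.prod ν), p ∈ Set.Ioi (0 : ℝ) ×ˢ Set.Ioi (0 : ℝ) := by
      simp only [ν]
      rw [Measure.prod_restrict]
      exact ae_restrict_mem (measurableSet_Ioi.prod measurableSet_Ioi)
    refine integral_congr_ae ?_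
    filter_upwards [hpos, hInt.prod_left_ae] with p hp hpi
    rw [← integral_integral_mul_exp_stdGaussian h hp.2]
    exact integral_prod _ hpi
  simp_rw [hl] at hswap
  rw [integral_const_mul, hr] at hswap
  have hpi : ((Real.pi / 2 : ℝ) : ℂ) ≠ 0 := by
    rw [Ne, Complex.ofReal_eq_zero]
    positivity
  refine mul_left_cancel₀ hpi (hswap.trans ?_)
  push_cast
  ring

end ComplexSign

end Grothendieck

namespace Grothendieck

open Matrix MeasureTheory ProbabilityTheory

/-! ### Haagerup's identity for correlation matrices. -/

section ComplexSignKernel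

theorem ae_ne_zero_stdGaussian_complex : ∀ᵐ w ∂(stdGaussian ℂ), w ≠ 0 := by
  rw [stdGaussian_complex]
  refine (ae_map_iff (p := fun w : ℂ => w ≠ 0) (by fun_prop)
    (measurableSet_singleton 0).compl).2 ?_
  refine (Measure.quasiMeasurePreserving_fst (μ := gaussianReal 0 1)
    (ν := gaussianReal 0 1)).ae (p := fun x => x ≠ 0) ae_ne_zero_gaussianReal |>.mono ?_
  intro q hq h
  exact hq (by simpa using congrArg Complex.re h)

theorem ae_fst_ne_zero_stdGaussian_complex :
    ∀ᵐ w ∂((stdGaussian ℂ).prod (stdGaussian ℂ)), w.1 ≠ 0 :=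
  (Measure.quasiMeasurePreserving_fst (μ := stdGaussian ℂ)
    (ν := stdGaussian ℂ)).ae (p := fun x => x ≠ 0) ae_ne_zero_stdGaussian_complex

/-- At ζ = 1 and σ = 0 the two phases coincide, so their correlation is 1. -/
theorem signSeries_one : signSeries 1 = 4 / Real.pi := by
  have h := integral_integral_unimodularSign_complex (ζ := 1) (σ := 0) (by simp)
  have h1 : ∫ w : ℂ × ℂ, unimodularSign w.1 * star (unimodularSign (1 * w.1 + (0 : ℝ) • w.2))
      ∂((stdGaussian ℂ).prod (stdGaussian ℂ)) = ∫ w : ℂ × ℂ, (1 : ℂ)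
      ∂((stdGaussian ℂ).prod (stdGaussian ℂ)) := by
    refine integral_congr_ae (ae_fst_ne_zero_stdGaussian_complex.mono fun w hw => ?_)
    simp only [one_mul, zero_smul, add_zero]
    rw [Complex.star_def, Complex.mul_conj, Complex.normSq_eq_norm_sq, norm_unimodularSign hw]
    simp
  rw [h1] at h
  simp only [integral_const, probReal_univ, one_smul, star_one, norm_one, one_pow, one_mul] at h
  have h2 : Real.pi / 4 * signSeries 1 = 1 := by exact_mod_cast h.symm
  rw [eq_div_iff Real.pi_ne_zero]
  linarith

theorem euclideanSpace_real_inner_eq_re {ι : Type*} [Fintype ι] (x y : EuclideanSpace ℂ ι) :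
    inner ℝ x y = (inner ℂ x y).re := by
  rw [PiLp.inner_apply, PiLp.inner_apply, Complex.re_sum]
  refine Finset.sum_congr rfl fun i _ => ?_
  rw [Complex.inner, RCLike.inner_apply, mul_comm]

/-- The law of a pair of complex linear functionals of a standard Gaussian vector. -/
theorem map_inner_prodMk_stdGaussian {ι : Type*} [Fintype ι] {x y : EuclideanSpace ℂ ι}
    (hx : ‖x‖ = 1) (hy : ‖y‖ = 1) {σ : ℝ} (hσ : ‖inner ℂ y x‖ ^ 2 + σ ^ 2 = 1) :
    (stdGaussian (EuclideanSpace ℂ ι)).map (fun z => (inner ℂ x z, inner ℂ y z)) =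
      ((stdGaussian ℂ).prod (stdGaussian ℂ)).map (fun w => (w.1, inner ℂ y x * w.1 + σ • w.2)) := by
  refine map_prodMk_stdGaussian ((innerSL ℂ x).restrictScalars ℝ) ((innerSL ℂ y).restrictScalars ℝ)
    (ContinuousLinearMap.mul ℝ ℂ (inner ℂ y x)) σ (fun t => t • x) (fun t => t • y)
    (fun t => star (inner ℂ y x) * t) ?_ ?_ ?_ ?_
  · intro t z
    rw [euclideanSpace_real_inner_eq_re (t • x) z, inner_smul_left, Complex.inner]
    simp [mul_comm]
  · intro t z
    rw [euclideanSpace_real_inner_eq_re (t • y) z, inner_smul_left, Complex.inner]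
    simp [mul_comm]
  · intro t z
    rw [Complex.inner, Complex.inner]
    simp
    ring
  · intro s t
    rw [norm_add_sq (𝕜 := ℂ), norm_add_sq (𝕜 := ℂ), inner_smul_left, inner_smul_right, norm_smul,
      norm_smul, hx, hy, norm_mul, norm_star]
    have : inner ℂ s (star (inner ℂ y x) * t) = (starRingEnd ℂ) s * (t * inner ℂ x y) := by
      rw [RCLike.inner_apply, ← inner_conj_symm x y, Complex.star_def]
      ring
    rw [this]
    linear_combination -‖t‖ ^ 2 * hσ

theorem norm_eq_one_of_inner_self {E : Type*} [NormedAddCommGroup E] [InnerProductSpace ℂ E] {x : E}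
    (h : inner ℂ x x = 1) : ‖x‖ = 1 := by
  have h1 := inner_self_eq_norm_sq (𝕜 := ℂ) x
  rw [h] at h1
  have h2 : ‖x‖ ^ 2 = 1 := by simpa using h1.symm
  exact (pow_eq_one_iff_of_nonneg (norm_nonneg _) two_ne_zero).1 h2

/-- Haagerup's identity: the phases of a complex Gaussian vector with correlation matrix `S` have
covariances `(π/4) S_ij G(|S_ij|²)`, where `G` is `signSeries`. -/
theorem signSeries_mem_roundedMatrices {k : ℕ} (hk : 1 ≤ k) {S : Matrix (Fin k) (Fin k) ℂ}
    (hS : S ∈ correlationMatrices ℂ k) :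
    (Matrix.of fun i j => S i j * ((Real.pi / 4 * signSeries (‖S i j‖ ^ 2) : ℝ) : ℂ)) ∈
      roundedMatrices ℂ k := by
  obtain ⟨v, hv⟩ := exists_gram_eq hS.1
  have hvn : ∀ i, ‖v i‖ = 1 := fun i => norm_eq_one_of_inner_self (by rw [hv, hS.2])
  let μ := stdGaussian (EuclideanSpace ℂ (Fin k))
  have hpair : ∀ i j (σ : ℝ), ‖inner ℂ (v j) (v i)‖ ^ 2 + σ ^ 2 = 1 →
      μ.map (fun x => (inner ℂ (v i) x, inner ℂ (v j) x)) =
      ((stdGaussian ℂ).prod (stdGaussian ℂ)).map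
        (fun w => (w.1, inner ℂ (v j) (v i) * w.1 + σ • w.2)) := by
    intro i j σ hσ
    exact map_inner_prodMk_stdGaussian (hvn i) (hvn j) hσ
  have hmeas : ∀ i, Measurable fun x : EuclideanSpace ℂ (Fin k) =>
      unimodularSign (inner ℂ (v i) x) :=
    fun i => measurable_unimodularSign.comp (by fun_prop)
  have hone : ∀ i, ∀ᵐ x ∂μ, inner ℂ (v i) x ≠ 0 := by
    intro i
    have h1 := hpair i i 0 (by simp [hvn])
    refine ae_of_ae_map (f := fun x => (inner ℂ (v i) x, inner ℂ (v i) x))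
      (p := fun w : ℂ × ℂ => w.1 ≠ 0) (by fun_prop) ?_
    rw [h1]
    exact (ae_map_iff (p := fun w : ℂ × ℂ => w.1 ≠ 0) (by fun_prop)
      (measurable_fst (measurableSet_singleton 0)).compl).2 ae_fst_ne_zero_stdGaussian_complex
  have hmem := of_integral_mem_roundedMatrices hk μ
    (p := fun x i => unimodularSign (inner ℂ (v i) x))
    (fun i => (hone i).mono fun x hx => norm_unimodularSign hx) hmeas
  convert hmem using 1
  ext i j
  simp only [of_apply]
  have hle : ‖inner ℂ (v j) (v i)‖ ^ 2 ≤ 1 := by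
    have := norm_inner_le_norm (𝕜 := ℂ) (v j) (v i)
    rw [hvn, hvn, one_mul] at this
    exact pow_le_one₀ (norm_nonneg _) this
  have hσ1 : ‖inner ℂ (v j) (v i)‖ ^ 2 + √(1 - ‖inner ℂ (v j) (v i)‖ ^ 2) ^ 2 = 1 := by
    rw [Real.sq_sqrt (sub_nonneg.2 hle)]
    ring
  have hm2 : Measurable fun w : ℂ × ℂ => unimodularSign w.1 * star (unimodularSign w.2) :=
    (measurable_unimodularSign.comp measurable_fst).mul
      (continuous_star.measurable.comp (measurable_unimodularSign.comp measurable_snd))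
  have h2 : ∫ x, unimodularSign (inner ℂ (v i) x) * star (unimodularSign (inner ℂ (v j) x)) ∂μ =
      ∫ w : ℂ × ℂ, unimodularSign w.1 * star (unimodularSign w.2)
        ∂(μ.map (fun x => (inner ℂ (v i) x, inner ℂ (v j) x))) := by
    rw [integral_map (by fun_prop) hm2.aestronglyMeasurable]
  rw [h2, hpair i j _ hσ1, integral_map (by fun_prop) hm2.aestronglyMeasurable,
    integral_integral_unimodularSign_complex hσ1, Complex.star_def, inner_conj_symm, hv,
    ← hv i j, norm_inner_symm]

end ComplexSignKernel

/-! ### Exponential kernels in R. -/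

section ExpKernel

theorem prod_mem_roundedMatrices {k : ℕ} (hk : 1 ≤ k) {ι : Type*} (s : Finset ι)
    {X : ι → Fin k → Fin k → ℝ}
    (hX : ∀ l ∈ s, (Matrix.of fun i j => ((X l i j : ℝ) : ℂ)) ∈ roundedMatrices ℂ k) :
    (Matrix.of fun i j => ((∏ l ∈ s, X l i j : ℝ) : ℂ)) ∈ roundedMatrices ℂ k := by
  classical
  induction s using Finset.induction_on with
  | empty => simpa using one_mem_roundedMatrices (𝕜 := ℂ) hk
  | insert a s ha ih =>
    have h := hadamard_mem_roundedMatrices hk (hX a (Finset.mem_insert_self a s))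
      (ih fun l hl => hX l (Finset.mem_insert_of_mem hl))
    convert h using 1
    ext i j
    simp [Finset.prod_insert ha]

/-- The entries are the characteristic function of a Gaussian of variance t at `a i - a j`, hence
averages of products of unimodular characters. -/
theorem exp_sq_sub_mem_roundedMatrices {k : ℕ} (hk : 1 ≤ k) (a : Fin k → ℝ) {t : ℝ} (ht : 0 ≤ t) :
    (Matrix.of fun i j => ((Real.exp (-(t * (a i - a j) ^ 2 / 2)) : ℝ) : ℂ)) ∈
      roundedMatrices ℂ k := by
  have h := of_integral_mem_roundedMatrices (𝕜 := ℂ) hk (gaussianReal 0 t.toNNReal)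
    (p := fun ω i => Complex.exp ((ω * a i : ℝ) * Complex.I))
    (fun i => Filter.Eventually.of_forall fun ω => Complex.norm_exp_ofReal_mul_I _)
    (fun i => by fun_prop)
  convert h using 1
  ext i j
  simp only [of_apply]
  have e : ∀ ω : ℝ, Complex.exp ((ω * a i : ℝ) * Complex.I) *
      star (Complex.exp ((ω * a j : ℝ) * Complex.I)) =
      Complex.exp (((a i - a j : ℝ) : ℂ) * ω * Complex.I) := by
    intro ω
    rw [Complex.star_def, ← Complex.exp_conj, ← Complex.exp_add]
    congr 1
    simp
    ring
  simp_rw [e]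
  rw [← charFun_apply_real, charFun_gaussianReal, Real.coe_toNNReal t ht]
  push_cast
  congr 1
  ring

/-- For a Gram representation by unit vectors, Re X - 1 is minus half the squared distance, so the
kernel is a product of one-dimensional Gaussian kernels over real coordinates. -/
theorem exp_re_sub_one_mem_roundedMatrices {k : ℕ} (hk : 1 ≤ k) {X : Matrix (Fin k) (Fin k) ℂ}
    (hX : X ∈ correlationMatrices ℂ k) {t : ℝ} (ht : 0 ≤ t) :
    (Matrix.of fun i j => ((Real.exp (t * ((X i j).re - 1)) : ℝ) : ℂ)) ∈ roundedMatrices ℂ k := by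
  obtain ⟨v, hv⟩ := exists_gram_eq hX.1
  have hvn : ∀ i, ‖v i‖ = 1 := fun i => norm_eq_one_of_inner_self (by rw [hv, hX.2])
  have h := prod_mem_roundedMatrices hk Finset.univ
    (X := fun l i j => Real.exp (-(t * ((v i l).re - (v j l).re) ^ 2 / 2)) *
      Real.exp (-(t * ((v i l).im - (v j l).im) ^ 2 / 2))) (fun l _ => by
      have := hadamard_mem_roundedMatrices hk
        (exp_sq_sub_mem_roundedMatrices hk (fun i => (v i l).re) ht)
        (exp_sq_sub_mem_roundedMatrices hk (fun i => (v i l).im) ht)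
      convert this using 1
      ext i j
      simp)
  convert h using 1
  ext i j
  simp only [of_apply]
  congr 1
  simp_rw [← Real.exp_add]
  rw [← Real.exp_sum]
  congr 1
  have h1 : ‖v i - v j‖ ^ 2 = 2 - 2 * (X i j).re := by
    rw [norm_sub_sq (𝕜 := ℂ), hvn, hvn, hv]
    simp
    ring
  rw [EuclideanSpace.norm_sq_eq] at h1
  have h2 : ∀ l, ‖(v i - v j) l‖ ^ 2 =
      ((v i l).re - (v j l).re) ^ 2 + ((v i l).im - (v j l).im) ^ 2 := by
    intro l
    rw [Complex.sq_norm, Complex.normSq_apply]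
    simp
    ring
  simp_rw [h2] at h1
  have h3 : ∀ l, -(t * ((v i l).re - (v j l).re) ^ 2 / 2) +
      -(t * ((v i l).im - (v j l).im) ^ 2 / 2) =
      -(t / 2) * (((v i l).re - (v j l).re) ^ 2 + ((v i l).im - (v j l).im) ^ 2) := by
    intro l
    ring
  simp_rw [h3]
  rw [← Finset.mul_sum, h1]
  ring

/-- Schur's product theorem, since |S|² is the entrywise product of S and its transpose. -/
theorem normSq_pow_mem_correlationMatrices {k : ℕ} {S : Matrix (Fin k) (Fin k) ℂ}
    (hS : S ∈ correlationMatrices ℂ k) (n : ℕ) :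
    (Matrix.of fun i j => (((‖S i j‖ ^ 2) ^ n : ℝ) : ℂ)) ∈ correlationMatrices ℂ k := by
  refine ⟨?_, fun i => by simp [hS.2]⟩
  induction n with
  | zero =>
    have : (Matrix.of fun i j => (((‖S i j‖ ^ 2) ^ 0 : ℝ) : ℂ)) =
        vecMulVec (fun _ : Fin k => (1 : ℂ)) (star fun _ : Fin k => (1 : ℂ)) := by
      ext i j
      simp [vecMulVec_apply]
    rw [this]
    exact posSemidef_vecMulVec_self_star _
  | succ n ih =>
    have := ih.hadamard (hS.1.hadamard hS.1.transpose)
    convert this using 1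
    ext i j
    have h1 : S j i = star (S i j) := (hS.1.isHermitian.apply i j).symm ▸ by simp
    simp only [of_apply, hadamard_apply, transpose_apply, h1, Complex.star_def, Complex.mul_conj,
      Complex.normSq_eq_norm_sq]
    push_cast
    ring

/-- Partial sums of the exponent give finite entrywise products of kernels in R, because the
coefficients are nonnegative; R is closed under the limit. -/
theorem exp_powerSeries_mem_roundedMatrices {k : ℕ} (hk : 1 ≤ k) {S : Matrix (Fin k) (Fin k) ℂ}
    (hS : S ∈ correlationMatrices ℂ k) {c : ℕ → ℝ} (hc : ∀ n, 0 ≤ c n) (hsum : Summable c)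
    (hle : ∀ i j, ‖S i j‖ ^ 2 ≤ 1) :
    (Matrix.of fun i j =>
      ((Real.exp (∑' n, c n * (‖S i j‖ ^ 2) ^ n - ∑' n, c n) : ℝ) : ℂ)) ∈ roundedMatrices ℂ k := by
  have h : ∀ N : ℕ, (Matrix.of fun i j =>
      ((∏ n ∈ Finset.range N, Real.exp (c n * ((‖S i j‖ ^ 2) ^ n - 1)) : ℝ) : ℂ)) ∈
        roundedMatrices ℂ k := fun N =>
    prod_mem_roundedMatrices hk _ fun n _ => by
      simpa [← Complex.ofReal_pow] using
        exp_re_sub_one_mem_roundedMatrices hk (normSq_pow_mem_correlationMatrices hS n) (hc n)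
  refine isClosed_roundedMatrices.mem_of_tendsto (b := Filter.atTop) ?_
    (Filter.Eventually.of_forall h)
  refine tendsto_pi_nhds.2 fun i => tendsto_pi_nhds.2 fun j => ?_
  simp only [of_apply]
  refine (Complex.continuous_ofReal.tendsto _).comp ?_
  simp_rw [← Real.exp_sum]
  refine (Real.continuous_exp.tendsto _).comp ?_
  have hs := summable_mul_pow_of_summable hc hsum (x := ‖S i j‖ ^ 2) ⟨by positivity, hle i j⟩
  have := (hs.hasSum.sub hsum.hasSum).tendsto_sum_nat
  simpa [mul_sub] using this

end ExpKernel

/-! ### The complex upper bound 8/π - 1. -/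

section ComplexBound

/-- Every complex correlation matrix is `4/π` times an average of rank one correlation matrices
minus `4/π - 1` times another one. -/
theorem isCorrelationBound_complex : IsCorrelationBound ℂ (8 / Real.pi - 1) := by
  rw [isCorrelationBound_iff]
  intro k hk B M hM S hS
  have hle : ∀ i j, ‖S i j‖ ^ 2 ≤ 1 := by
    intro i j
    obtain ⟨v, hv⟩ := exists_gram_eq hS.1
    have hvn : ∀ i, ‖v i‖ = 1 := fun i => norm_eq_one_of_inner_self (by rw [hv, hS.2])
    have := norm_inner_le_norm (𝕜 := ℂ) (v i) (v j)
    rw [hvn, hvn, one_mul, hv] at this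
    exact pow_le_one₀ (norm_nonneg _) this
  have hH := signSeries_mem_roundedMatrices hk hS
  set H : Matrix (Fin k) (Fin k) ℂ :=
    Matrix.of fun i j => S i j * ((Real.pi / 4 * signSeries (‖S i j‖ ^ 2) : ℝ) : ℂ) with hHd
  have hE := exp_powerSeries_mem_roundedMatrices hk hS quotientLogCoeff_nonneg
    summable_quotientLogCoeff hle
  set E : Matrix (Fin k) (Fin k) ℂ := Matrix.of fun i j =>
    ((Real.exp (∑' n, quotientLogCoeff n * (‖S i j‖ ^ 2) ^ n - ∑' n, quotientLogCoeff n) : ℝ) : ℂ)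
    with hEd
  have hQ := hadamard_mem_roundedMatrices hk (hadamard_mem_roundedMatrices hk
    (hadamard_mem_roundedMatrices hk hH hH) (map_star_mem_roundedMatrices hk hH)) hE
  set Q := H ⊙ H ⊙ H.map star ⊙ E with hQd
  -- The factorization at 1 evaluates the normalising constant exp(q(1)), which turns the
  -- coefficient of `Q` into 4/π - 1.
  have hone := signSeries_sub_one (x := 1) ⟨zero_le_one, le_rfl⟩
  simp only [one_pow, mul_one, signSeries_one] at hone
  have hdec : S = (4 / Real.pi) • H - (4 / Real.pi - 1) • Q := by
    ext i j
    have hx := signSeries_sub_one (x := ‖S i j‖ ^ 2) ⟨by positivity, hle i j⟩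
    have hreal : (1 : ℝ) = 4 / Real.pi * (Real.pi / 4 * signSeries (‖S i j‖ ^ 2)) -
        (4 / Real.pi - 1) * ((Real.pi / 4 * signSeries (‖S i j‖ ^ 2)) ^ 3 * ‖S i j‖ ^ 2 *
          Real.exp (∑' n, quotientLogCoeff n * (‖S i j‖ ^ 2) ^ n - ∑' n, quotientLogCoeff n)) := by
      rw [hone, Real.exp_sub]
      have hx' : 1 = signSeries (‖S i j‖ ^ 2) - ‖S i j‖ ^ 2 / 8 * signSeries (‖S i j‖ ^ 2) ^ 3 *
        Real.exp (∑' n, quotientLogCoeff n * (‖S i j‖ ^ 2) ^ n) := by linarith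
      refine hx'.trans ?_
      field_simp
    have hs : S i j * star (S i j) = ((‖S i j‖ ^ 2 : ℝ) : ℂ) := by
      rw [Complex.star_def, Complex.mul_conj, Complex.normSq_eq_norm_sq]
    have hc := congrArg (fun r : ℝ => (r : ℂ)) hreal
    simp only [hQd, hHd, hEd, Matrix.sub_apply, Matrix.smul_apply, hadamard_apply, map_apply,
      of_apply, star_mul, Complex.real_smul]
    have hst : ∀ r : ℝ, star (r : ℂ) = r := Complex.conj_ofReal
    rw [hst]
    generalize Real.pi / 4 * signSeries (‖S i j‖ ^ 2) = g at hc ⊢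
    generalize Real.exp _ = e at hc ⊢
    push_cast at hc hs ⊢
    linear_combination S i j * hc + S i j * (4 / Real.pi - 1) * g ^ 3 * e * hs
  have hπ : 1 ≤ 4 / Real.pi := by
    rw [le_div_iff₀ Real.pi_pos, one_mul]
    exact Real.pi_le_four
  have htr : (Bᴴ * S).trace = (4 / Real.pi) • (Bᴴ * H).trace -
      (4 / Real.pi - 1) • (Bᴴ * Q).trace := by
    conv_lhs => rw [hdec]
    rw [Matrix.mul_sub, Matrix.mul_smul, Matrix.mul_smul, trace_sub, trace_smul, trace_smul]
  rw [htr]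
  refine (norm_sub_le _ _).trans ?_
  rw [norm_smul, norm_smul, Real.norm_of_nonneg (by positivity),
    Real.norm_of_nonneg (by linarith)]
  have h1 := mul_le_mul_of_nonneg_left (norm_trace_le_of_mem_roundedMatrices hM hH)
    (show 0 ≤ 4 / Real.pi by positivity)
  have h2 := mul_le_mul_of_nonneg_left (norm_trace_le_of_mem_roundedMatrices hM hQ)
    (show 0 ≤ 4 / Real.pi - 1 by linarith)
  calc _ ≤ 4 / Real.pi * M + (4 / Real.pi - 1) * M := add_le_add h1 h2
    _ = _ := by ring

end ComplexBound

end Grothendieck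

namespace Grothendieck

open Matrix

/-! ### Strictness in the complex case. -/

section ComplexLowerBound

/-- The correlation matrix `1 + i C / √3`, where `C` is the skew conference matrix of order 4. -/
noncomputable def conferenceMatrix : Matrix (Fin 4) (Fin 4) ℂ :=
  let w : ℂ := ((√3)⁻¹ : ℝ) * Complex.I
  !![1, w, w, w; -w, 1, w, -w; -w, -w, 1, w; -w, w, -w, 1]

theorem conferenceMatrix_conjTranspose : conferenceMatrixᴴ = conferenceMatrix := by
  ext i j
  fin_cases i <;> fin_cases j <;> simp [conferenceMatrix]

/-- Since C² = -3, the matrix iC/√3 is an involution, so half of `conferenceMatrix` is an orthogonal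
projection. This yields positivity, trace value 8, and the bound 8 on unimodular vectors with
equality only in the range. -/
theorem conferenceMatrix_mul_self :
    conferenceMatrix * conferenceMatrix = (2 : ℝ) • conferenceMatrix := by
  have hw : (((√3)⁻¹ : ℝ) * Complex.I) * (((√3)⁻¹ : ℝ) * Complex.I) = -(1 / 3 : ℂ) := by
    have h3 : ((√3)⁻¹ : ℝ) * (√3)⁻¹ = 1 / 3 := by
      rw [← mul_inv, Real.mul_self_sqrt (by norm_num)]
      norm_num
    rw [mul_mul_mul_comm, ← Complex.ofReal_mul, h3, Complex.I_mul_I]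
    push_cast
    ring
  unfold conferenceMatrix
  generalize (((√3)⁻¹ : ℝ) : ℂ) * Complex.I = w at hw
  ext i j
  fin_cases i <;> fin_cases j <;> simp [mul_apply, Fin.sum_univ_succ] <;> grind

theorem conferenceMatrix_mem_correlationMatrices :
    conferenceMatrix ∈ correlationMatrices ℂ 4 := by
  constructor
  · have h := (posSemidef_conjTranspose_mul_self conferenceMatrix).smul
      (show (0 : ℝ) ≤ 1 / 2 by norm_num)
    rw [conferenceMatrix_conjTranspose, conferenceMatrix_mul_self, smul_smul] at h
    norm_num at h
    exact h
  · intro i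
    fin_cases i <;> simp [conferenceMatrix]

/-- No unimodular vector is an eigenvector of the conference matrix, in real coordinates. -/
theorem conference_form_bounds {t a b c d e f g h : ℝ} (ht : t ^ 2 = 1 / 3) (hp : a ^ 2 + b ^ 2 = 1)
    (hq : c ^ 2 + d ^ 2 = 1) (hr : e ^ 2 + f ^ 2 = 1) (hs : g ^ 2 + h ^ 2 = 1) :
    |4 + 2 * t * ((b * c - a * d) + (b * e - a * f) + (b * g - a * h) + (d * e - c * f) -
      (d * g - c * h) + (f * g - e * h))| < 8 := by
  set Q := 4 + 2 * t * ((b * c - a * d) + (b * e - a * f) + (b * g - a * h) + (d * e - c * f) -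
      (d * g - c * h) + (f * g - e * h)) with hQ
  -- For P the conference matrix and p the unimodular vector, `hlow` reads 2Q = ‖Pp‖² and `hupp`
  -- reads 2(8 - Q) = ‖(2 - P)p‖².
  have hlow : 2 * Q = (a - t * (d + f + h)) ^ 2 + (b + t * (c + e + g)) ^ 2 +
      (c - t * (-b + f - h)) ^ 2 + (d + t * (-a + e - g)) ^ 2 +
      (e - t * (-b - d + h)) ^ 2 + (f + t * (-a - c + g)) ^ 2 +
      (g - t * (-b + d - f)) ^ 2 + (h + t * (-a + c - e)) ^ 2 := by
    rw [hQ]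
    linear_combination -2 * hp - 2 * hq - 2 * hr - 2 * hs -
      3 * (a ^ 2 + b ^ 2 + c ^ 2 + d ^ 2 + e ^ 2 + f ^ 2 + g ^ 2 + h ^ 2) * ht
  have hupp : 2 * (8 - Q) = (a + t * (d + f + h)) ^ 2 + (b - t * (c + e + g)) ^ 2 +
      (c + t * (-b + f - h)) ^ 2 + (d - t * (-a + e - g)) ^ 2 +
      (e + t * (-b - d + h)) ^ 2 + (f - t * (-a - c + g)) ^ 2 +
      (g + t * (-b + d - f)) ^ 2 + (h - t * (-a + c - e)) ^ 2 := by
    rw [hQ]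
    linear_combination -2 * hp - 2 * hq - 2 * hr - 2 * hs -
      3 * (a ^ 2 + b ^ 2 + c ^ 2 + d ^ 2 + e ^ 2 + f ^ 2 + g ^ 2 + h ^ 2) * ht
  have h0 : 0 ≤ 2 * Q := by rw [hlow]; positivity
  rw [abs_of_nonneg (by linarith)]
  by_contra hcon
  have hz : ∀ {r₁ r₂ r₃ r₄ r₅ r₆ r₇ r₈ : ℝ}, 2 * (8 - Q) = r₁ ^ 2 + r₂ ^ 2 + r₃ ^ 2 + r₄ ^ 2 +
      r₅ ^ 2 + r₆ ^ 2 + r₇ ^ 2 + r₈ ^ 2 → r₁ = 0 ∧ r₂ = 0 ∧ r₃ = 0 ∧ r₄ = 0 := by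
    intro r₁ r₂ r₃ r₄ r₅ r₆ r₇ r₈ hr
    refine ⟨?_, ?_, ?_, ?_⟩ <;>
      refine pow_eq_zero_iff two_ne_zero |>.1 (le_antisymm ?_ (sq_nonneg _)) <;>
      linarith [sq_nonneg r₁, sq_nonneg r₂, sq_nonneg r₃, sq_nonneg r₄, sq_nonneg r₅, sq_nonneg r₆,
        sq_nonneg r₇, sq_nonneg r₈]
  -- If Q ≥ 8, then Pp = 2p. Its first two complex rows express the last two entries through the
  -- first two; unimodularity then forces the product of the first entry with the conjugate of the
  -- second to have real part 0 and squared imaginary part 1/3, although its modulus is 1.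
  obtain ⟨z1, z2, z3, z4⟩ := hz hupp
  have y1 : d + f + h = -(3 * t * a) := by linear_combination 3 * t * z1 - 3 * (d + f + h) * ht
  have y2 : c + e + g = 3 * t * b := by linear_combination -(3 * t) * z2 - 3 * (c + e + g) * ht
  have y3 : f - h = b - 3 * t * c := by linear_combination 3 * t * z3 - 3 * (-b + f - h) * ht
  have y4 : e - g = a + 3 * t * d := by linear_combination -(3 * t) * z4 - 3 * (-a + e - g) * ht
  have he : e = (3 * t * b - c + a + 3 * t * d) / 2 := by linarith
  have hf : f = (-(3 * t * a) - d + b - 3 * t * c) / 2 := by linarith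
  have hg : g = (3 * t * b - c - a - 3 * t * d) / 2 := by linarith
  have hh : h = (-(3 * t * a) - d - b + 3 * t * c) / 2 := by linarith
  rw [he, hf] at hr
  rw [hg, hh] at hs
  have hx : a * c + b * d = 0 := by
    linear_combination (hr - hs) / 2 - 9 / 2 * (a * c + b * d) * ht
  have hy : 3 * t * (b * c - a * d) = 1 := by
    linear_combination (-1 / 2) * (hr + hs) + hp + hq +
      9 / 4 * (a ^ 2 + b ^ 2 + c ^ 2 + d ^ 2) * ht
  have hxy : (a * c + b * d) ^ 2 + (b * c - a * d) ^ 2 = 1 := by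
    linear_combination (c ^ 2 + d ^ 2) * hp + hq
  have hy2 : 3 * (b * c - a * d) ^ 2 = 1 := by
    linear_combination (3 * t * (b * c - a * d) + 1) * hy - 9 * (b * c - a * d) ^ 2 * ht
  rw [hx] at hxy
  linarith

theorem not_isCorrelationBound_one_complex : ¬ IsCorrelationBound ℂ 1 := by
  intro h
  rw [isCorrelationBound_iff] at h
  obtain ⟨M, hM⟩ := exists_isGreatest_rankOneValues (by norm_num) conferenceMatrix
  have h1 := h 4 (by norm_num) conferenceMatrix M hM _ conferenceMatrix_mem_correlationMatrices
  have hM8 : M < 8 := by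
    obtain ⟨T, hT, rfl⟩ := hM.1
    obtain ⟨p, hp, rfl⟩ := (mem_rankOneCorrelationMatrices_iff (by norm_num)).1 hT
    have hp' : ∀ i, (p i).re ^ 2 + (p i).im ^ 2 = 1 := fun i => by
      have := Complex.sq_norm (p i)
      rw [hp i, Complex.normSq_apply] at this
      linarith
    have ht : ((√3)⁻¹ : ℝ) ^ 2 = 1 / 3 := by
      rw [inv_pow, Real.sq_sqrt (by norm_num)]
      norm_num
    have hb := conference_form_bounds ht (hp' 0) (hp' 1) (hp' 2) (hp' 3)
    refine lt_of_eq_of_lt ?_ hb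
    rw [trace_conjTranspose_mul, ← Real.norm_eq_abs, ← Complex.norm_real]
    congr 1
    have h0 := hp' 0
    have h1 := hp' 1
    have h2 := hp' 2
    have h3 := hp' 3
    apply Complex.ext
    · simp [Fin.sum_univ_succ, vecMulVec_apply, conferenceMatrix]
      linear_combination h0 + h1 + h2 + h3
    · simp [Fin.sum_univ_succ, vecMulVec_apply, conferenceMatrix]
      ring
  have htr : (conferenceMatrixᴴ * conferenceMatrix).trace = 8 := by
    rw [conferenceMatrix_conjTranspose, conferenceMatrix_mul_self, trace_smul]
    simp [trace, Fin.sum_univ_succ, conferenceMatrix]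
    norm_num
  rw [htr] at h1
  norm_num at h1
  linarith

end ComplexLowerBound

end Grothendieck

theorem mainTheorem3 :
    (IsLeast {K : ℝ | Grothendieck.IsGrothendieckBound.{u} ℝ K}
        (Grothendieck.grothendieckConstant.{u} ℝ) ∧
      ∃ K : ℝ, 1 < K ∧ IsLeast {L : ℝ | Grothendieck.IsCorrelationBound ℝ L} K ∧
        (∀ k : ℕ, 1 ≤ k → Grothendieck.correlationMatrices ℝ k ⊆
          K • absConvexHull ℝ (Grothendieck.rankOneCorrelationMatrices ℝ k)) ∧
        K ∈ Set.Icc (Grothendieck.grothendieckConstant.{u} ℝ) (Real.sinh (Real.pi / 2))) ∧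
    (IsLeast {K : ℝ | Grothendieck.IsGrothendieckBound.{u} ℂ K}
        (Grothendieck.grothendieckConstant.{u} ℂ) ∧
      ∃ K : ℝ, 1 < K ∧ IsLeast {L : ℝ | Grothendieck.IsCorrelationBound ℂ L} K ∧
        (∀ k : ℕ, 1 ≤ k → Grothendieck.correlationMatrices ℂ k ⊆
          K • absConvexHull ℂ (Grothendieck.rankOneCorrelationMatrices ℂ k)) ∧
        K ∈ Set.Icc (Grothendieck.grothendieckConstant.{u} ℂ) (8 / Real.pi - 1)) := by
  exact ⟨Grothendieck.constants_of_isCorrelationBound Grothendieck.isCorrelationBound_real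
      Grothendieck.not_isCorrelationBound_one_real,
    Grothendieck.constants_of_isCorrelationBound Grothendieck.isCorrelationBound_complex
      Grothendieck.not_isCorrelationBound_one_complex⟩
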